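/- Let $p$ be a prime, $n\ge 1$, and let $\rho: G_{\mathbb Q}\to \mathrm{GL}_n(\overline{\mathbb F}_p)$ be a continuous semisimple representation; let $\omega$ be the mod $p$ cyclotomic character and $s\in\mathbb Z$. For each prime $q$ fix a decomposition group $G_q$ at $q$, with inertia group $I_q$. *Level and nebentype.* $N(\rho)=\prod_{q\ne p}q^{n_q}$ with $n_q=\sum_{i\ge 0}\frac{g_i}{g_0}\dim M/M^{G_{q,i}}$, where $M=\overline{\mathbb F}_p^n$, $G_{q,i}$ are the (lower) ramification groups at $q$ of the extension of $\mathbb Q$ cut out by $\rho$, and $g_i=|\rho(G_{q,i})|$. Write $\det\rho=\omega^k\epsilon$ with $\epsilon$ unramified at $p$; the nebentype $\epsilon(\rho)$ is $\epsilon$, regarded by class field theory as a Dirichlet character modulo $N(\rho)$ (so $\epsilon(\mathrm{Frob}_\ell)=\epsilon(\ell)$). *Strict parity.* A standard Levi subgroup $L$ of $\mathrm{GL}_n(\overline{\mathbb F}_p)$ is the simultaneous stabilizer of subspaces $D_1,\dots,D_k$ with $\overline{\mathbb F}_p^n=\bigoplus D_i$, each spanned by standard basis vectors; it is $\rho$-minimal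 if it is minimal among the standard Levi subgroups that contain a conjugate of the image of $\rho$. The representation $\rho$ satisfies strict parity with $L$ if $L$ is $\rho$-minimal, contains the image of $\rho$, and $\rho$(complex conjugation) is conjugate in $L$ to $\pm\mathrm{diag}(1,-1,1,\dots)$. *Derived tuples.* Let $D$ be a $d$-dimensional $\overline{\mathbb F}_p[G_p]$-module. Choose a composition series $0=V_0\subset\dots\subset V_r=D$ and a basis $e_1,\dots,e_d$ of $D$ adapted to it for which $I_p$ acts diagonally on each $V_i/V_{i-1}$. If $\dim V_i/V_{i-1}=f$, choose an integer $m$ such that $\psi^{m}$ is one of the characters of $I_p$ on $V_i/V_{i-1}$, $\psi$ being a fundamental character of niveau $f$, and such that $m=\alpha_1+\alpha_2p+\dots+\alpha_fp^{f-1}$ with integers satisfying $0\le\alpha_j-\alpha_f\le p-1$ for all $j$; arrange the $\alpha_j$ in decreasing order. Concatenating these tuples for $i=1,\dots,r$, one gets a $d$-tuple whose $j$-th entry belongs to $e_j$. Reorder basis and tuple simultaneously by any permutation that keeps the order within each composition factor and for which the action of $I_p$ is still upper triangular. The resulting $d$-tuples are *derived from* $D$. If $\rho$ has image in the $\rho$-minimal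 standard Levi subgroup $L$, an $n$-tuple is *derived from $\rho$ with Levi subgroup $L$* if, for each $i$, its entries at the indices of the standard basis vectors spanning $D_i$, in increasing order, form a tuple derived from $D_i$. *Weights.* A tuple $b\in\mathbb Z^n$ is $p$-restricted if $0\le b_i-b_{i+1}\le p-1$ for $i<n$ and $0\le b_n<p-1$; then $F(b)$ denotes the restriction to $\mathrm{GL}_n(\mathbb F_p)$ of the unique simple submodule of the dual Weyl module of $\mathrm{GL}_n(\overline{\mathbb F}_p)$ with highest weight $b$. For $a\in\mathbb Z^n$, $F(a)'$ is $F(b)$ for a $p$-restricted $b$ with $b_i\equiv a_i \pmod{p-1}$ for all $i$; if there are several, a statement about $F(a)'$ means the statement for some such $b$. The *predicted weights* of $\rho$ are all the modules $F(a_1-(n-1),a_2-(n-2),\dots,a_n)'$ (all choices of $b$ allowed), for all $n$-tuples $a$ derived from $\rho$ with a Levi subgroup $L$ for which $\rho$ satisfies strict parity. *Attached classes.* $\Gamma_0(N)\subset\mathrm{SL}_n(\mathbb Z)$ is the group of matrices with first row $\equiv(*,0,\dots,0)$ mod $N$. For a $\mathrm{GL}_n(\mathbb F_p)$-module $V$ and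 a Dirichlet character $\epsilon$ mod $N$, with $p\nmid N$, $V(\epsilon)$ is $V$ with the action, twisted by $\epsilon$ of the $(1,1)$ entry, of the integral matrices of positive determinant prime to $pN$ with first row $\equiv(*,0,\dots,0)$ mod $N$. For primes $\ell\nmid pN$ and $0\le k\le n$ let $T(\ell,k)$ be the Hecke operator on $H^*(\Gamma_0(N),V(\epsilon))$ of the double coset of $\mathrm{diag}(1,\dots,1,\ell,\dots,\ell)$ ($k$ entries $\ell$). Then $\rho$ is *attached* to a class $v\neq0$ if $\rho$ is unramified outside $pN$ and, for all $\ell\nmid pN$, $T(\ell,k)v=a(\ell,k)v$ for $0\le k\le n$ and $\sum_{k=0}^n(-1)^k\ell^{k(k-1)/2}a(\ell,k)X^k=\det(I-\rho(\mathrm{Frob}_\ell)X)$, with $\mathrm{Frob}_\ell$ the arithmetic Frobenius. *Conjecture for $\rho$.* Whenever $\rho$ satisfies strict parity with $L$ and $a$ is derived from $\rho$ with Levi subgroup $L$, $\rho$ is attached to a cohomology eigenclass in $H^*(\Gamma_0(N),V(\epsilon))$, where $N=N(\rho)$, $\epsilon=\epsilon(\rho)$ and $V=F(a_1-(n-1),a_2-(n-2),\dots,a_n)'$.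 **Theorem.** If the conjecture is true for $\rho$, then it is true for $\rho\otimes\omega^s$. Moreover (whether or not the conjecture is true for $\rho$): $\rho\otimes\omega^s$ has the same level and the same nebentype as $\rho$; for each standard Levi subgroup $L$, the tuple $(a_1+s,\dots,a_n+s)$ is derived from $\rho\otimes\omega^s$ with $L$ if and only if $(a_1,\dots,a_n)$ is derived from $\rho$ with $L$; and the predicted weights of $\rho\otimes\omega^s$ are, up to isomorphism, exactly the modules $V\otimes\det^s$ with $V$ a predicted weight of $\rho$. -/

import Mathlib

open scoped NumberField MatrixGroups Pointwise

noncomputable section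

namespace ADP

/-! ## Galois groups, Galois representations, the cyclotomic character -/

/-- The field of algebraic numbers. -/
abbrev Qbar : Type := AlgebraicClosure ℚ

/-- The absolute Galois group of `ℚ`, with its Krull topology. -/
abbrev GQ : Type := Gal(Qbar/ℚ)

/-- An algebraic closure of the field with `p` elements. -/
abbrev Fbar (p : ℕ) [Fact p.Prime] : Type := AlgebraicClosure (ZMod p)

variable {p : ℕ} [Fact p.Prime] {n : ℕ}

/-- The action of `G_ℚ` on `𝔽̄_pⁿ` defined by `ρ`. -/
def galRep (ρ : GQ →* GL (Fin n) (Fbar p)) : Representation (Fbar p) GQ (Fin n → Fbar p) :=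
  (Matrix.toLinAlgEquiv' (R := Fbar p) (n := Fin n)).toAlgHom.toMonoidHom.comp
    ((Units.coeHom _).comp ρ)

/-- Continuity of `ρ`, for the discrete topology on `GL_n(𝔽̄_p)`. -/
def IsContinuousRep (ρ : GQ →* GL (Fin n) (Fbar p)) : Prop :=
  @Continuous GQ (GL (Fin n) (Fbar p)) inferInstance ⊥ ρ

/-- `ρ` is a semisimple representation. -/
def IsSemisimpleRep (ρ : GQ →* GL (Fin n) (Fbar p)) : Prop :=
  (galRep ρ).IsSemisimpleRepresentation

/-- The mod `p` cyclotomic character `ω`, with values in `𝔽̄_pˣ`. -/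
def cyclo (p : ℕ) [Fact p.Prime] : GQ →* (Fbar p)ˣ :=
  (Units.map (algebraMap (ZMod p) (Fbar p)).toMonoidHom).comp
    ((modularCyclotomicCharacter Qbar
        (HasEnoughRootsOfUnity.natCard_rootsOfUnity Qbar p)).comp
      (MulSemiringAction.toRingAut GQ Qbar))

/-- The twist `ρ ⊗ ω^s`. -/
def twist (ρ : GQ →* GL (Fin n) (Fbar p)) (s : ℤ) : GQ →* GL (Fin n) (Fbar p) where
  toFun g := Matrix.GeneralLinearGroup.scalar (Fin n) (cyclo p g ^ s) * ρ g
  map_one' := by simp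
  map_mul' g h := by
    have hc : ∀ (u : (Fbar p)ˣ) (A : GL (Fin n) (Fbar p)),
        A * Matrix.GeneralLinearGroup.scalar (Fin n) u =
          Matrix.GeneralLinearGroup.scalar (Fin n) u * A := by
      intro u A
      ext i j
      simp [Matrix.GeneralLinearGroup.scalar, Matrix.scalar_apply, mul_comm]
    rw [map_mul, map_mul, mul_zpow, map_mul, mul_assoc, mul_assoc, ← mul_assoc (ρ g), hc,
      mul_assoc]

/-! ## Primes of `ℚ̄`, decomposition, inertia and ramification groups -/

/-- `𝔮` is a prime of the ring of algebraic integers above the prime number `q`. -/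
def IsPrimeAbove (q : ℕ) (𝔮 : Ideal (𝓞 Qbar)) : Prop := 𝔮.IsPrime ∧ (q : 𝓞 Qbar) ∈ 𝔮

/-- The decomposition group of a prime `𝔮` of `ℚ̄`. -/
def decomp (𝔮 : Ideal (𝓞 Qbar)) : Subgroup GQ := MulAction.stabilizer GQ 𝔮

/-- The inertia group of a prime `𝔮` of `ℚ̄`. -/
def inert (𝔮 : Ideal (𝓞 Qbar)) : Subgroup GQ := 𝔮.inertia GQ

/-- `ρ` is unramified at the prime number `q`. -/
def IsUnramifiedAt {H : Type} [Group H] (ρ : GQ →* H) (q : ℕ) : Prop :=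
  ∀ 𝔮 : Ideal (𝓞 Qbar), IsPrimeAbove q 𝔮 → ∀ τ ∈ inert 𝔮, ρ τ = 1

/-- The field cut out by `ρ`. -/
abbrev cutField (ρ : GQ →* GL (Fin n) (Fbar p)) : IntermediateField ℚ Qbar :=
  IntermediateField.fixedField ρ.ker

/-- The inverse image in `G_ℚ` of the `i`-th ramification group (lower numbering) of `Gal(K/ℚ)`
at the prime `𝔮 ∩ 𝓞 K`, where `K` is the field cut out by `ρ`: the `σ` with
`σ x ≡ x` modulo `(𝔮 ∩ 𝓞 K)^(i+1)` for all `x` in `𝓞 K`. -/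
def ramGroup (ρ : GQ →* GL (Fin n) (Fbar p)) (𝔮 : Ideal (𝓞 Qbar)) (i : ℕ) : Set GQ :=
  {σ | ∀ x : 𝓞 (cutField ρ), ∃ y ∈ (𝔮.under (𝓞 (cutField ρ))) ^ (i + 1),
    σ • algebraMap (𝓞 (cutField ρ)) (𝓞 Qbar) x - algebraMap (𝓞 (cutField ρ)) (𝓞 Qbar) x =
      algebraMap (𝓞 (cutField ρ)) (𝓞 Qbar) y}

/-- The vectors of `𝔽̄_pⁿ` fixed by a set of elements of `G_ℚ`. -/
def fixedVectors (ρ : GQ →* GL (Fin n) (Fbar p)) (T : Set GQ) :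
    Submodule (Fbar p) (Fin n → Fbar p) :=
  ⨅ σ ∈ T, LinearMap.ker (galRep ρ σ - LinearMap.id)

/-- The exponent `n_q = ∑_i (g_i / g_0) dim (M / M^{G_{q,i}})`, with `g_i = |ρ(G_{q,i})|`,
computed at a prime `𝔮` above `q`.  (It is an integer for `q ≠ p`, so that the rounding in the
definition of the level changes nothing.) -/
def conductorExponent (ρ : GQ →* GL (Fin n) (Fbar p)) (𝔮 : Ideal (𝓞 Qbar)) : ℚ :=
  ∑ᶠ i : ℕ, ((ρ '' ramGroup ρ 𝔮 i).ncard : ℚ) / ((ρ '' ramGroup ρ 𝔮 0).ncard : ℚ) *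
    (Module.finrank (Fbar p) ((Fin n → Fbar p) ⧸ fixedVectors ρ (ramGroup ρ 𝔮 i)) : ℚ)

/-- The level `N(ρ) = ∏_{q ≠ p} q^{n_q}`, computed with a chosen prime `𝔔 q` of `ℚ̄` above each
prime number `q`. -/
def level (𝔔 : ℕ → Ideal (𝓞 Qbar)) (ρ : GQ →* GL (Fin n) (Fbar p)) : ℕ :=
  ∏ᶠ (q : ℕ) (_ : q.Prime ∧ q ≠ p), q ^ ⌊conductorExponent ρ (𝔔 q)⌋₊

/-- `ε`, a Dirichlet character modulo `N`, is the nebentype of `ρ`: one has `det ρ = ω^k ε'` with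
a character `ε'` of `G_ℚ` unramified at `p` that corresponds to `ε` by class field theory, i.e.
`ε'(σ) = ε(u)` if `σ` acts on the `N`-th roots of unity as `ζ ↦ ζ^u`. -/
def IsNebentype (ρ : GQ →* GL (Fin n) (Fbar p)) {N : ℕ} (ε : DirichletCharacter (Fbar p) N) :
    Prop :=
  ∃ (k : ℤ) (ε' : GQ →* (Fbar p)ˣ),
    (∀ σ, Matrix.GeneralLinearGroup.det (ρ σ) = cyclo p σ ^ k * ε' σ) ∧
    IsUnramifiedAt ε' p ∧
    ∀ (σ : GQ) (u : (ZMod N)ˣ), (∀ ζ : Qbar, ζ ^ N = 1 → σ ζ = ζ ^ (u : ZMod N).val) →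
      (ε' σ : Fbar p) = ε u

/-! ## Standard Levi subgroups and strict parity -/

/-- The span of the standard basis vectors whose index is in the class of `i`. -/
def blockSpace (p : ℕ) [Fact p.Prime] (S : Setoid (Fin n)) (i : Fin n) :
    Submodule (Fbar p) (Fin n → Fbar p) :=
  Submodule.span (Fbar p) ((fun j => Pi.single j 1) '' {j | S i j})

/-- The standard Levi subgroup of `GL_n(𝔽̄_p)` attached to a partition of the set of standard
basis vectors (given as an equivalence relation): the simultaneous stabilizer of the subspaces
spanned by the classes. -/
def stdLevi (p : ℕ) [Fact p.Prime] (S : Setoid (Fin n)) : Subgroup (GL (Fin n) (Fbar p)) where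
  carrier := {g | ∀ i, (blockSpace p S i).map (Matrix.toLin' (g : Matrix _ _ (Fbar p))) =
    blockSpace p S i}
  one_mem' := by intro i; simp
  mul_mem' := by
    intro a b ha hb i
    rw [Units.val_mul, Matrix.toLin'_mul, Submodule.map_comp, hb i, ha i]
  inv_mem' := by
    intro a ha i
    have h : Matrix.toLin' ((a⁻¹ : GL (Fin n) (Fbar p)) : Matrix (Fin n) (Fin n) (Fbar p)) ∘ₗ
        Matrix.toLin' (a : Matrix (Fin n) (Fin n) (Fbar p)) = LinearMap.id := by
      rw [← Matrix.toLin'_mul, ← Units.val_mul, inv_mul_cancel, Units.val_one, Matrix.toLin'_one]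
    conv_lhs => rw [← ha i]
    rw [← Submodule.map_comp, h, Submodule.map_id]

/-- `L` is a standard Levi subgroup which contains some conjugate of the image of `ρ`. -/
def ContainsConjugate (ρ : GQ →* GL (Fin n) (Fbar p)) (L : Subgroup (GL (Fin n) (Fbar p))) :
    Prop :=
  (∃ S : Setoid (Fin n), L = stdLevi p S) ∧ ∃ h, ∀ σ, h * ρ σ * h⁻¹ ∈ L

/-- The image of `ρ` lies in the standard Levi subgroup of `S`, and this group is `ρ`-minimal. -/
def LandsInMinimal (ρ : GQ →* GL (Fin n) (Fbar p)) (S : Setoid (Fin n)) : Prop :=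
  (∀ σ, ρ σ ∈ stdLevi p S) ∧ Minimal (ContainsConjugate ρ) (stdLevi p S)

/-- `ρ` satisfies the strict parity condition with the standard Levi subgroup of `S`. -/
def StrictParity (ρ : GQ →* GL (Fin n) (Fbar p)) (S : Setoid (Fin n)) : Prop :=
  LandsInMinimal ρ S ∧
  ∀ (φ : Qbar →+* ℂ) (c : GQ), NumberField.ComplexEmbedding.IsConj φ c →
    ∃ h ∈ stdLevi p S, ∃ e : Fbar p, (e = 1 ∨ e = -1) ∧
      ((h * ρ c * h⁻¹ : GL (Fin n) (Fbar p)) : Matrix (Fin n) (Fin n) (Fbar p)) =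
        Matrix.diagonal fun i : Fin n => e * (-1) ^ (i : ℕ)

/-! ## Fundamental characters and derived tuples -/

/-- `ψ` is one of the fundamental characters of niveau `d` of the inertia group at `𝔓`:
`ψ(τ)` is the image of `τ(ϖ)/ϖ` in the residue field, embedded in `𝔽̄_p`, where
`ϖ ^ (p ^ d - 1) = p`.  (The `d` embeddings of the field with `p ^ d` elements into `𝔽̄_p` give the
`d` fundamental characters of niveau `d`.) -/
def IsFundamentalCharacter (𝔓 : Ideal (𝓞 Qbar)) (d : ℕ) (ψ : inert 𝔓 →* (Fbar p)ˣ) : Prop :=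
  ∃ (ι : (𝓞 Qbar ⧸ 𝔓) →+* Fbar p) (ϖ : 𝓞 Qbar), ϖ ^ (p ^ d - 1) = (p : 𝓞 Qbar) ∧
    ∀ τ : inert 𝔓, ∃ u : 𝓞 Qbar, (τ : GQ) • ϖ = u * ϖ ∧
      (ψ τ : Fbar p) = ι (Ideal.Quotient.mk 𝔓 u)

/-- `b` is the decreasing `d`-tuple obtained from the digits of an expansion
`m = α_1 + α_2 p + ⋯ + α_d p^(d-1)` with `0 ≤ α_r - α_d ≤ p - 1` for all `r`. -/
def IsDigitTuple (p d : ℕ) (m : ℤ) (b : Fin d → ℤ) : Prop :=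
  ∃ α : Fin d → ℤ, m = ∑ r, α r * (p : ℤ) ^ (r : ℕ) ∧
    (∀ r t : Fin d, (t : ℕ) + 1 = d → 0 ≤ α r - α t ∧ α r - α t ≤ (p : ℤ) - 1) ∧
    Antitone b ∧ ∃ π : Equiv.Perm (Fin d), b = α ∘ π

/-- `U` is stable under the decomposition group at `𝔓`. -/
def IsDecompStable (ρ : GQ →* GL (Fin n) (Fbar p)) (𝔓 : Ideal (𝓞 Qbar))
    (U : Submodule (Fbar p) (Fin n → Fbar p)) : Prop :=
  ∀ g ∈ decomp 𝔓, ∀ v ∈ U, galRep ρ g v ∈ U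

/-- The `t`-th step of the filtration spanned by initial segments of the family `e`, the
successive quotients having the dimensions prescribed by the composition `c`. -/
def flag {d : ℕ} (e : Fin d → Fin n → Fbar p) (c : Composition d) (t : ℕ) :
    Submodule (Fbar p) (Fin n → Fbar p) :=
  Submodule.span (Fbar p) (e '' {j | (j : ℕ) < c.sizeUpTo t})

/-- The `d`-tuple `a` is derived from the subspace `D`, considered as a module for the
decomposition group `G_p` at `𝔓`. -/
def IsDerivedFromSpace (ρ : GQ →* GL (Fin n) (Fbar p)) (𝔓 : Ideal (𝓞 Qbar))
    (D : Submodule (Fbar p) (Fin n → Fbar p)) {d : ℕ} (a : Fin d → ℤ) : Prop :=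
  ∃ (e : Fin d → Fin n → Fbar p) (c : Composition d) (φ : Fin d → inert 𝔓 → Fbar p)
    (a₀ : Fin d → ℤ) (σ : Equiv.Perm (Fin d)),
    -- `e` is a basis of `D`
    LinearIndependent (Fbar p) e ∧ Submodule.span (Fbar p) (Set.range e) = D ∧
    -- its initial segments span a composition series of the `G_p`-module `D`
    (∀ t ≤ c.length, IsDecompStable ρ 𝔓 (flag e c t)) ∧
    (∀ t < c.length, ∀ U, IsDecompStable ρ 𝔓 U → flag e c t ≤ U → U ≤ flag e c (t + 1) →
      U = flag e c t ∨ U = flag e c (t + 1)) ∧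
    -- inertia acts diagonally on each composition factor, through the characters `φ`
    (∀ (t : Fin c.length) (x : Fin (c.blocksFun t)) (τ : inert 𝔓),
      galRep ρ τ (e (c.embedding t x)) - φ (c.embedding t x) τ • e (c.embedding t x) ∈
        flag e c t) ∧
    -- `a₀` is the concatenation of tuples derived from the composition factors
    (∀ t : Fin c.length, ∃ (m : ℤ) (ψ : inert 𝔓 →* (Fbar p)ˣ),
      IsFundamentalCharacter 𝔓 (c.blocksFun t) ψ ∧
      (∃ x, ∀ τ, φ (c.embedding t x) τ = ((ψ τ ^ m : (Fbar p)ˣ) : Fbar p)) ∧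
      IsDigitTuple p (c.blocksFun t) m (a₀ ∘ c.embedding t)) ∧
    -- `σ` moves the `j`-th basis vector to position `σ j`; it keeps the order within each factor,
    -- and inertia remains upper triangular for the reordered basis
    (∀ t : Fin c.length, StrictMono (σ ∘ c.embedding t)) ∧
    (∀ (τ : inert 𝔓) (j : Fin d),
      galRep ρ τ (e j) ∈ Submodule.span (Fbar p) (e '' {j' | σ j' ≤ σ j})) ∧
    ∀ j, a (σ j) = a₀ j

open Classical in
/-- The class of `i` for the equivalence relation `S`, as a finite set. -/
def blockIdx (S : Setoid (Fin n)) (i : Fin n) : Finset (Fin n) := {j | S i j}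

/-- The `n`-tuple `b` is derived from `ρ` with the standard Levi subgroup of `S`: on each block,
read in increasing order, it is derived from the space spanned by the block. -/
def IsDerivedTuple (ρ : GQ →* GL (Fin n) (Fbar p)) (𝔓 : Ideal (𝓞 Qbar)) (S : Setoid (Fin n))
    (b : Fin n → ℤ) : Prop :=
  LandsInMinimal ρ S ∧
  ∀ i : Fin n, IsDerivedFromSpace ρ 𝔓 (blockSpace p S i)
    (fun r => b ((blockIdx S i).orderEmbOfFin rfl r))

/-! ## Irreducible modules of `GL_n(𝔽_p)` -/

/-- The tuple `b` is `p`-restricted. -/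
def IsPRestricted (p : ℕ) [NeZero n] (b : Fin n → ℤ) : Prop :=
  (∀ i j : Fin n, (j : ℕ) = i + 1 → 0 ≤ b i - b j ∧ b i - b j ≤ (p : ℤ) - 1) ∧
  0 ≤ b (Fin.rev 0) ∧ b (Fin.rev 0) < (p : ℤ) - 1

/-- The action of `GL_n(𝔽̄_p)` on functions on `GL_n(𝔽̄_p)`, `(h f)(g) = f(g h)`. -/
def translation (p n : ℕ) [Fact p.Prime] :
    Representation (Fbar p) (GL (Fin n) (Fbar p)) (GL (Fin n) (Fbar p) → Fbar p) where
  toFun h :=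
    { toFun := fun f g => f (g * h)
      map_add' := fun _ _ => rfl
      map_smul' := fun _ _ => rfl }
  map_one' := by ext f g; simp
  map_mul' h k := by ext f g; simp [mul_assoc]

/-- The coordinate ring of the algebraic group `GL_n` over `𝔽̄_p`: the algebra of functions
generated by the matrix entries and the inverse of the determinant. -/
def regularFunctions (p n : ℕ) [Fact p.Prime] :
    Subalgebra (Fbar p) (GL (Fin n) (Fbar p) → Fbar p) :=
  Algebra.adjoin (Fbar p)
    (Set.range (fun (ij : Fin n × Fin n) (g : GL (Fin n) (Fbar p)) =>
        (g : Matrix (Fin n) (Fin n) (Fbar p)) ij.1 ij.2) ∪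
      {fun g : GL (Fin n) (Fbar p) => ((g : Matrix (Fin n) (Fin n) (Fbar p)).det)⁻¹})

/-- The dual Weyl module `W(b)` with highest weight `b`: the regular functions `f` on `GL_n` with
`f(β g) = β_11^{b_1} ⋯ β_nn^{b_n} f(g)` for all lower triangular `β`, with the action of `GL_n` by
right translation. -/
def dualWeyl (p : ℕ) [Fact p.Prime] (b : Fin n → ℤ) :
    Submodule (Fbar p) (GL (Fin n) (Fbar p) → Fbar p) where
  carrier := {f | f ∈ regularFunctions p n ∧ ∀ β g : GL (Fin n) (Fbar p),
    (∀ i j, i < j → (β : Matrix (Fin n) (Fin n) (Fbar p)) i j = 0) →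
      f (β * g) = (∏ i, (β : Matrix (Fin n) (Fin n) (Fbar p)) i i ^ b i) * f g}
  zero_mem' := ⟨Subalgebra.zero_mem _, by simp⟩
  add_mem' := fun hf hg => ⟨Subalgebra.add_mem _ hf.1 hg.1, fun β g hβ => by
    simp [hf.2 β g hβ, hg.2 β g hβ, mul_add]⟩
  smul_mem' := fun c f hf => ⟨Subalgebra.smul_mem _ hf.1 c, fun β g hβ => by
    simp [hf.2 β g hβ, mul_left_comm]⟩

/-- The simple `GL_n(𝔽̄_p)`-submodule of the dual Weyl module `W(b)`, for a decreasing tuple `b`.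
As there is exactly one, it is the sum of all simple submodules. -/
def simpleSub (p : ℕ) [Fact p.Prime] (b : Fin n → ℤ) : Subrepresentation (translation p n) where
  toSubmodule := ⨆ U : {U : Subrepresentation (translation p n) //
    IsAtom U ∧ U.toSubmodule ≤ dualWeyl p b}, U.1.toSubmodule
  apply_mem_toSubmodule := by
    intro g v hv
    have h : (⨆ U : {U : Subrepresentation (translation p n) //
        IsAtom U ∧ U.toSubmodule ≤ dualWeyl p b}, U.1.toSubmodule) ≤
        (⨆ U : {U : Subrepresentation (translation p n) //
          IsAtom U ∧ U.toSubmodule ≤ dualWeyl p b}, U.1.toSubmodule).comap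
            (translation p n g) := by
      refine iSup_le fun U w hw => ?_
      exact (le_iSup (fun U : {U : Subrepresentation (translation p n) //
        IsAtom U ∧ U.toSubmodule ≤ dualWeyl p b} => U.1.toSubmodule) U)
          (U.1.apply_mem_toSubmodule g hw)
    exact h hv

/-- The underlying space of `F(b)`. -/
abbrev WeightSpace (p : ℕ) [Fact p.Prime] (b : Fin n → ℤ) : Type :=
  (simpleSub p b).toSubmodule

/-- The `GL_n(𝔽_p)`-module `F(b)`. -/
def weightRep (p : ℕ) [Fact p.Prime] (b : Fin n → ℤ) :
    Representation (Fbar p) (GL (Fin n) (ZMod p)) (WeightSpace p b) :=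
  (simpleSub p b).toRepresentation.comp
    (Matrix.GeneralLinearGroup.map (algebraMap (ZMod p) (Fbar p)))

/-- The one-dimensional `GL_n(𝔽_p)`-module `det^s`. -/
def detRep (p n : ℕ) [Fact p.Prime] (s : ℤ) :
    Representation (Fbar p) (GL (Fin n) (ZMod p)) (Fbar p) :=
  (algebraMap (Fbar p) (Module.End (Fbar p) (Fbar p))).toMonoidHom.comp
    ((Units.coeHom _).comp ((Units.map (algebraMap (ZMod p) (Fbar p)).toMonoidHom).comp
      ((zpowGroupHom s).comp Matrix.GeneralLinearGroup.det)))

/-- `F(b)` is (one of the modules denoted by) `F(a_1, …, a_n)'`. -/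
def IsPrimed (p : ℕ) [NeZero n] (a b : Fin n → ℤ) : Prop :=
  IsPRestricted p b ∧ ∀ i, a i ≡ b i [ZMOD (p : ℤ) - 1]

/-! ## Congruence subgroups, Hecke operators and attached eigenclasses -/

section Hecke

variable [NeZero n]

/-- The first row of `A` is congruent to `(*, 0, …, 0)` modulo `N`. -/
def FirstRow (N : ℕ) (A : Matrix (Fin n) (Fin n) ℤ) : Prop := ∀ j, j ≠ 0 → (N : ℤ) ∣ A 0 j

lemma FirstRow.mul {N : ℕ} {A B : Matrix (Fin n) (Fin n) ℤ} (hA : FirstRow N A)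
    (hB : FirstRow N B) : FirstRow N (A * B) := by
  intro j hj
  rw [Matrix.mul_apply]
  refine Finset.dvd_sum fun k _ => ?_
  by_cases hk : k = 0
  · subst hk; exact Dvd.dvd.mul_left (hB j hj) _
  · exact Dvd.dvd.mul_right (hA k hk) _

lemma FirstRow.one (N : ℕ) : FirstRow N (1 : Matrix (Fin n) (Fin n) ℤ) := by
  intro j hj
  simp [Matrix.one_apply_ne hj.symm]

lemma FirstRow.mul_zero {N : ℕ} {A B : Matrix (Fin n) (Fin n) ℤ} (hA : FirstRow N A)
    (j : Fin n) : (((A * B) 0 j : ℤ) : ZMod N) = (A 0 0 : ZMod N) * (B 0 j : ZMod N) := by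
  rw [Matrix.mul_apply, Int.cast_sum, Finset.sum_eq_single 0]
  · push_cast; rfl
  · intro k _ hk
    rw [Int.cast_mul, (ZMod.intCast_zmod_eq_zero_iff_dvd _ _).2 (hA k hk), zero_mul]
  · intro h; exact absurd (Finset.mem_univ 0) h

/-- The semigroup of integral matrices whose first row is congruent to `(*, 0, …, 0)` modulo `N`
and whose determinant is positive and prime to `pN`.  It contains `Γ_0(N)` and `S_{pN}`. -/
def heckeMonoid (p n N : ℕ) [NeZero n] : Submonoid (Matrix (Fin n) (Fin n) ℤ) where
  carrier := {A | FirstRow N A ∧ 0 < A.det ∧ IsCoprime A.det ((p * N : ℕ) : ℤ)}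
  one_mem' := ⟨FirstRow.one N, by simp, by simpa using isCoprime_one_left⟩
  mul_mem' := fun hA hB => ⟨hA.1.mul hB.1, by rw [Matrix.det_mul]; exact mul_pos hA.2.1 hB.2.1,
    by rw [Matrix.det_mul]; exact hA.2.2.mul_left hB.2.2⟩

/-- The reduction modulo `p` of an element of the semigroup. -/
def redModP {N : ℕ} : heckeMonoid p n N →* GL (Fin n) (ZMod p) where
  toFun A := Matrix.GeneralLinearGroup.mk'' ((Int.castRingHom (ZMod p)).mapMatrix A.1) (by
    rw [← RingHom.map_det]
    have h := A.2.2.2.map (Int.castRingHom (ZMod p))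
    simpa [isCoprime_zero_right] using h)
  map_one' := by ext i j; simp [Matrix.one_apply]
  map_mul' A B := Units.ext (map_mul (RingHom.mapMatrix _) A.1 B.1)

/-- An element of the semigroup as an element of `GL_n(ℚ)`. -/
def toGLQ {N : ℕ} : heckeMonoid p n N →* GL (Fin n) ℚ where
  toFun A := Matrix.GeneralLinearGroup.mk'' ((Int.castRingHom ℚ).mapMatrix A.1) (by
    rw [← RingHom.map_det]
    simpa using A.2.2.1.ne')
  map_one' := by ext i j; simp [Matrix.one_apply]
  map_mul' A B := Units.ext (map_mul (RingHom.mapMatrix _) A.1 B.1)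

/-- The group `Γ_0(N)` of matrices in `SL_n(ℤ)` whose first row is congruent to `(*, 0, …, 0)`
modulo `N`. -/
def Gamma0 (n N : ℕ) [NeZero n] : Subgroup SL(n, ℤ) where
  carrier := {A | FirstRow N A.1}
  one_mem' := FirstRow.one N
  mul_mem' := fun hA hB => hA.mul hB
  inv_mem' := by
    intro A hA j hj
    have h0 := FirstRow.mul_zero (B := (A⁻¹).1) hA 0
    have h1 := FirstRow.mul_zero (B := (A⁻¹).1) hA j
    have hAA : A.1 * (A⁻¹).1 = 1 := by
      rw [← Matrix.SpecialLinearGroup.coe_mul, mul_inv_cancel, Matrix.SpecialLinearGroup.coe_one]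
    rw [hAA] at h0 h1
    rw [Matrix.one_apply_eq, Int.cast_one] at h0
    rw [Matrix.one_apply_ne hj.symm, Int.cast_zero] at h1
    rw [← ZMod.intCast_zmod_eq_zero_iff_dvd]
    calc (((A⁻¹).1 0 j : ℤ) : ZMod N)
        = (((A⁻¹).1 0 0 : ℤ) : ZMod N) * ((A.1 0 0 : ZMod N) * ((A⁻¹).1 0 j : ZMod N)) := by
          rw [← mul_assoc, mul_comm (((A⁻¹).1 0 0 : ℤ) : ZMod N), ← h0, one_mul]
      _ = 0 := by rw [← h1, mul_zero]

/-- The inclusion of `Γ_0(N)` in the semigroup. -/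
def gammaIncl (p : ℕ) {n N : ℕ} [NeZero n] : Gamma0 n N →* heckeMonoid p n N where
  toFun γ := ⟨γ.1.1, γ.2, by simp, by simpa using isCoprime_one_left⟩
  map_one' := rfl
  map_mul' _ _ := rfl

/-- The action of the semigroup on `V(ε) = V ⊗ 𝔽_ε`: through the reduction modulo `p` on the
`GL_n(𝔽_p)`-module `V`, and through `ε` of the `(1,1)` entry. -/
def coeffRep {N : ℕ} {V : Type} [AddCommGroup V] [Module (Fbar p) V]
    (τ : Representation (Fbar p) (GL (Fin n) (ZMod p)) V) (ε : DirichletCharacter (Fbar p) N) :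
    Representation (Fbar p) (heckeMonoid p n N) V where
  toFun A := ε (A.1 0 0 : ZMod N) • τ (redModP A)
  map_one' := by simp
  map_mul' A B := by
    have h : (((A * B : heckeMonoid p n N).1 0 0 : ℤ) : ZMod N) =
        (A.1 0 0 : ZMod N) * (B.1 0 0 : ZMod N) := A.2.1.mul_zero 0
    rw [h, map_mul, map_mul, map_mul, smul_mul_smul_comm]

/-- `V(ε)` as a `Γ_0(N)`-module. -/
abbrev gammaRep {N : ℕ} {V : Type} [AddCommGroup V] [Module (Fbar p) V]
    (τ : Representation (Fbar p) (GL (Fin n) (ZMod p)) V) (ε : DirichletCharacter (Fbar p) N) :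
    Rep (Fbar p) (Gamma0 n N) :=
  Rep.of (MonoidHom.comp (coeffRep τ ε) (gammaIncl p) : Representation (Fbar p) (Gamma0 n N) V)

section Cohomology

variable {N : ℕ} {V : Type} [AddCommGroup V] [Module (Fbar p) V]
  (τ : Representation (Fbar p) (GL (Fin n) (ZMod p)) V) (ε : DirichletCharacter (Fbar p) N)

/-- Homogeneous `i`-cocycles of `Γ_0(N)` with values in `V(ε)`, for the resolution by the free
`Γ_0(N)`-sets `GL_n(ℚ)^{i+1}`. -/
def IsHomogeneousCocycle {i : ℕ} (F : (Fin (i + 1) → GL (Fin n) ℚ) → V) : Prop :=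
  (∀ (γ : Gamma0 n N) (x : Fin (i + 1) → GL (Fin n) ℚ),
    F (fun j => toGLQ (gammaIncl p γ) * x j) = coeffRep τ ε (gammaIncl p γ) (F x)) ∧
  ∀ x : Fin (i + 2) → GL (Fin n) ℚ, ∑ j : Fin (i + 2), (-1 : ℤ) ^ (j : ℕ) • F (x ∘ j.succAbove) = 0

/-- `v` is the cohomology class of the homogeneous cocycle `F`: the class of the inhomogeneous
cocycle `(g_1, …, g_i) ↦ F(1, g_1, g_1 g_2, …, g_1 ⋯ g_i)`. -/
def IsClassOf {i : ℕ} (v : groupCohomology (gammaRep τ ε) i)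
    (F : (Fin (i + 1) → GL (Fin n) ℚ) → V) : Prop :=
  ∃ z : groupCohomology.cocycles (gammaRep τ ε) i,
    (∀ g : Fin i → Gamma0 n N, groupCohomology.iCocycles (gammaRep τ ε) i z g =
      F (fun j => toGLQ (gammaIncl p (Fin.partialProd g j)))) ∧
    groupCohomology.π (gammaRep τ ε) i z = v

/-- The group `Γ ∩ D Γ D⁻¹` for `Γ = Γ_0(N)`. -/
def heckeStab (D : heckeMonoid p n N) : Subgroup (Gamma0 n N) :=
  ((toGLQ.comp (gammaIncl p (n := n) (N := N))).range).comap
    ((MulAut.conj (toGLQ D)⁻¹).toMonoidHom.comp (toGLQ.comp (gammaIncl p)))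

/-- The Hecke operator of the double coset `Γ D Γ = ⊔_j s_j Γ` on cochains,
`(T F)(x) = ∑ s_j F(s_j⁻¹ x)`.  The representatives are `s_j = γ D`, with `γ` running through
representatives of `Γ / (Γ ∩ D Γ D⁻¹)`. -/
def heckeCochain (D : heckeMonoid p n N) {i : ℕ} (F : (Fin (i + 1) → GL (Fin n) ℚ) → V) :
    (Fin (i + 1) → GL (Fin n) ℚ) → V := fun x =>
  ∑ᶠ c : Gamma0 n N ⧸ heckeStab D,
    coeffRep τ ε (gammaIncl p c.out * D) (F fun j => (toGLQ (gammaIncl p c.out * D))⁻¹ * x j)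

/-- `w` is the image of `v` under the Hecke operator of the double coset of `D`. -/
def IsHeckeImage (D : heckeMonoid p n N) {i : ℕ} (v w : groupCohomology (gammaRep τ ε) i) :
    Prop :=
  ∃ F : (Fin (i + 1) → GL (Fin n) ℚ) → V, IsHomogeneousCocycle τ ε F ∧
    IsClassOf τ ε v F ∧ IsClassOf τ ε w (heckeCochain τ ε D F)

/-- The matrix `D(ℓ,k) = diag(1, …, 1, ℓ, …, ℓ)` with `k` entries `ℓ`, for a prime `ℓ` not
dividing `pN`. -/
def heckeD (l k : ℕ) (hl : l.Prime) (h : ¬ l ∣ p * N) : heckeMonoid p n N :=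
  ⟨Matrix.diagonal fun i : Fin n => if (i : ℕ) + k < n then 1 else (l : ℤ), by
    refine ⟨fun j hj => by simp [Matrix.diagonal_apply_ne _ hj.symm], ?_, ?_⟩
    · rw [Matrix.det_diagonal]
      refine Finset.prod_pos fun i _ => ?_
      split_ifs
      · exact one_pos
      · exact_mod_cast hl.pos
    · rw [Matrix.det_diagonal]
      refine IsCoprime.prod_left fun i _ => ?_
      split_ifs
      · exact isCoprime_one_left
      · exact Nat.isCoprime_iff_coprime.2 ((Nat.Prime.coprime_iff_not_dvd hl).2 h)⟩

/-- `ρ` is attached to the class `v` in `H^i(Γ_0(N), V(ε))`: `v` is a nonzero simultaneous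
eigenvector of the Hecke operators `T(ℓ,k)`, with eigenvalues `a(ℓ,k)`, for the primes `ℓ` not
dividing `pN` and `0 ≤ k ≤ n`; `ρ` is unramified outside `pN`; and
`∑_k (-1)^k ℓ^{k(k-1)/2} a(ℓ,k) X^k = det(1 - ρ(Frob_ℓ) X)` for all these `ℓ`. -/
def IsAttached (ρ : GQ →* GL (Fin n) (Fbar p)) {i : ℕ}
    (v : groupCohomology (gammaRep τ ε) i) : Prop :=
  v ≠ 0 ∧ ∃ a : ℕ → ℕ → Fbar p,
    ∀ (l : ℕ) (hl : l.Prime) (h : ¬ l ∣ p * N),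
      (∀ k ≤ n, IsHeckeImage τ ε (heckeD l k hl h) v (a l k • v)) ∧
      IsUnramifiedAt ρ l ∧
      ∀ (𝔩 : Ideal (𝓞 Qbar)) (σ : GQ), IsPrimeAbove l 𝔩 → IsArithFrobAt ℤ σ 𝔩 →
        ∑ k ∈ Finset.range (n + 1),
            Polynomial.C ((-1) ^ k * (l : Fbar p) ^ (k * (k - 1) / 2) * a l k) *
              Polynomial.X ^ k =
          Matrix.charpolyRev (ρ σ : Matrix (Fin n) (Fin n) (Fbar p))

end Cohomology

/-! ## The conjecture -/

/-- `F(b)` is a weight predicted for `ρ` by the derived tuple `a`: it is (one of the modules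
denoted by) `F(a_1 - (n - 1), a_2 - (n - 2), …, a_n - 0)'`. -/
def IsWeightOf (p : ℕ) (a b : Fin n → ℤ) : Prop :=
  IsPrimed p (fun i => a i - ((n : ℤ) - 1 - (i : ℕ))) b

/-- The set of all `b` such that `F(b)` is a weight predicted for `ρ`. -/
def predictedWeights (𝔔 : ℕ → Ideal (𝓞 Qbar)) (ρ : GQ →* GL (Fin n) (Fbar p)) :
    Set (Fin n → ℤ) :=
  {b | ∃ (S : Setoid (Fin n)) (a : Fin n → ℤ),
    StrictParity ρ S ∧ IsDerivedTuple ρ (𝔔 p) S a ∧ IsWeightOf p a b}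

/-- The conjecture for the representation `ρ`: if `ρ` satisfies strict parity with the standard
Levi subgroup of `S`, and `a` is derived from `ρ` with this Levi subgroup, then `ρ` is attached to
a cohomology eigenclass in `H^*(Γ_0(N), V(ε))`, where `N` and `ε` are the level and the nebentype
of `ρ` and `V = F(a_1 - (n - 1), …, a_n - 0)'`; when the latter notation is ambiguous, this is
claimed for one of the modules that it may denote. -/
def ConjectureFor (𝔔 : ℕ → Ideal (𝓞 Qbar)) (ρ : GQ →* GL (Fin n) (Fbar p)) : Prop :=
  ∀ (S : Setoid (Fin n)) (a : Fin n → ℤ), StrictParity ρ S → IsDerivedTuple ρ (𝔔 p) S a →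
    ∃ (ε : DirichletCharacter (Fbar p) (level 𝔔 ρ)) (b : Fin n → ℤ) (i : ℕ)
      (v : groupCohomology (gammaRep (weightRep p b) ε) i),
      IsNebentype ρ ε ∧ IsWeightOf p a b ∧ IsAttached (weightRep p b) ε ρ v

end Hecke

end ADP

end

open scoped NumberField MatrixGroups Pointwise

noncomputable section

namespace ADP

variable {p : ℕ} [Fact p.Prime] {n : ℕ}

/-! ## Twisting by powers of the cyclotomic character -/

/-! Twisting multiplies each `ρ g` by the scalar `ω(g)^s`, and each ingredient of the conjecture
responds to this scalar in a controlled way.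

Scalars lie in every standard Levi subgroup and stabilize every subspace, so minimal Levi subgroups
and composition series are unchanged. Since `ω(c)^s = ±1` for complex conjugation `c`, strict parity
survives, and `det ρ` changes only by a power of `ω`. A fundamental character `ψ` of niveau `d`
satisfies `ψ^(1 + p + ... + p^(d-1)) = ω` (`IsFundamentalCharacter.pow_eq_cyclo`), so twisting adds
`s` to every digit of an exponent, hence to every entry of a derived tuple.

On the side of weights, multiplication by `det^t` carries the simple submodule for `b` to the one
for `b + t` (`map_simpleSub`). On `GL_n(𝔽_p)` only `t` modulo `p - 1` matters, which leaves room to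
choose `b + t` restricted. As `Γ_0(N)` has determinant one, tensoring with `det^s` does not alter
the cohomology; it only multiplies `T(ℓ,k)` by `ℓ^(sk)`. This is the substitution `X ↦ ℓ^s X` in the
Hecke polynomial, in accordance with `ω(Frob_ℓ) = ℓ` (`IsDetTwist.isAttached`).

The level needs the most work. Although `ω` is trivial on inertia at `q ≠ p`, `ρ` and its twist cut
out different fields, while lower ramification groups are defined by each field separately. Both
fields yield the same field after a `p`-th root of unity is adjoined. That extension is unramified
at `q`, so it does not disturb the filtration on inertia (`mem_ramSet_iff_of_le`). -/

lemma twist_apply (ρ : GQ →* GL (Fin n) (Fbar p)) (s : ℤ) (g : GQ) :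
    twist ρ s g = Matrix.GeneralLinearGroup.scalar (Fin n) (cyclo p g ^ s) * ρ g := rfl

lemma scalar_mul_comm (u : (Fbar p)ˣ) (A : GL (Fin n) (Fbar p)) :
    A * Matrix.GeneralLinearGroup.scalar (Fin n) u =
      Matrix.GeneralLinearGroup.scalar (Fin n) u * A := by
  ext i j
  simp [Matrix.GeneralLinearGroup.scalar, Matrix.scalar_apply, mul_comm]

/-- Makes twisting invertible, so each implication from `ρ` to its twist also yields the converse,
by applying it with `-s`. -/
lemma twist_twist_neg (ρ : GQ →* GL (Fin n) (Fbar p)) (s : ℤ) :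
    twist (twist ρ s) (-s) = ρ := by
  ext1 g
  rw [twist_apply, twist_apply, ← mul_assoc, ← map_mul, ← zpow_add, neg_add_cancel, zpow_zero,
    map_one, one_mul]

lemma coe_scalar_mul (u : (Fbar p)ˣ) (A : GL (Fin n) (Fbar p)) :
    ((Matrix.GeneralLinearGroup.scalar (Fin n) u * A : GL (Fin n) (Fbar p)) :
      Matrix (Fin n) (Fin n) (Fbar p)) = (u : Fbar p) • (A : Matrix (Fin n) (Fin n) (Fbar p)) := by
  ext i j
  simp [Matrix.GeneralLinearGroup.scalar, Matrix.scalar_apply]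

lemma coe_twist (ρ : GQ →* GL (Fin n) (Fbar p)) (s : ℤ) (g : GQ) :
    (twist ρ s g : Matrix (Fin n) (Fin n) (Fbar p)) =
      ((cyclo p g ^ s : (Fbar p)ˣ) : Fbar p) • (ρ g : Matrix (Fin n) (Fin n) (Fbar p)) :=
  coe_scalar_mul _ _

lemma galRep_apply (ρ : GQ →* GL (Fin n) (Fbar p)) (g : GQ) (v : Fin n → Fbar p) :
    galRep ρ g v = (ρ g : Matrix (Fin n) (Fin n) (Fbar p)).mulVec v := rfl

lemma galRep_twist (ρ : GQ →* GL (Fin n) (Fbar p)) (s : ℤ) (g : GQ) (v : Fin n → Fbar p) :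
    galRep (twist ρ s) g v = ((cyclo p g ^ s : (Fbar p)ˣ) : Fbar p) • galRep ρ g v := by
  rw [galRep_apply, galRep_apply, coe_twist, Matrix.smul_mulVec]

lemma twist_eq_of_cyclo_eq_one (ρ : GQ →* GL (Fin n) (Fbar p)) (s : ℤ) {g : GQ}
    (hg : cyclo p g = 1) : twist ρ s g = ρ g := by
  rw [twist_apply, hg, one_zpow, map_one, one_mul]

/-! ## Nebentype -/

lemma det_twist (ρ : GQ →* GL (Fin n) (Fbar p)) (s : ℤ) (g : GQ) :
    Matrix.GeneralLinearGroup.det (twist ρ s g) =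
      cyclo p g ^ (s * n) * Matrix.GeneralLinearGroup.det (ρ g) := by
  ext
  simp [coe_twist, zpow_mul]

/-- The determinant is multiplied by `ω^(sn)`, which is absorbed by the exponent `k`; the part
unramified at `p` is untouched. -/
lemma IsNebentype.twist {ρ : GQ →* GL (Fin n) (Fbar p)} {N : ℕ}
    {ε : DirichletCharacter (Fbar p) N} (h : IsNebentype ρ ε) (s : ℤ) :
    IsNebentype (twist ρ s) ε := by
  obtain ⟨k, ε', hdet, hrest⟩ := h
  refine ⟨s * n + k, ε', fun σ => ?_, hrest⟩
  rw [det_twist, hdet, zpow_add, mul_assoc]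

lemma isNebentype_twist_iff {ρ : GQ →* GL (Fin n) (Fbar p)} {N : ℕ}
    {ε : DirichletCharacter (Fbar p) N} (s : ℤ) :
    IsNebentype (twist ρ s) ε ↔ IsNebentype ρ ε :=
  ⟨fun h => by simpa only [twist_twist_neg] using h.twist (-s), fun h => h.twist s⟩

/-! ## Levi subgroups and strict parity -/

lemma scalar_mem_stdLevi (S : Setoid (Fin n)) (u : (Fbar p)ˣ) :
    Matrix.GeneralLinearGroup.scalar (Fin n) u ∈ stdLevi p S := by
  intro i
  have h : Matrix.toLin' ((Matrix.GeneralLinearGroup.scalar (Fin n) u : GL (Fin n) (Fbar p)) :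
      Matrix (Fin n) (Fin n) (Fbar p)) = (u : Fbar p) • LinearMap.id := by
    ext
    simp [Matrix.GeneralLinearGroup.scalar, Matrix.scalar_apply, Pi.single_apply]
  rw [h, Submodule.map_smul _ _ _ u.ne_zero, Submodule.map_id]

lemma twist_mem_stdLevi_iff (ρ : GQ →* GL (Fin n) (Fbar p)) (s : ℤ) (S : Setoid (Fin n))
    (h : GL (Fin n) (Fbar p)) (g : GQ) :
    h * twist ρ s g * h⁻¹ ∈ stdLevi p S ↔ h * ρ g * h⁻¹ ∈ stdLevi p S := by
  rw [twist_apply, ← mul_assoc h, scalar_mul_comm, mul_assoc, mul_assoc,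
    Subgroup.mul_mem_cancel_left _ (scalar_mem_stdLevi S _), ← mul_assoc]

/-- Scalars are central and belong to every standard Levi subgroup, so the factor `ω^s` has no
effect on membership, even after conjugation. -/
lemma containsConjugate_twist (ρ : GQ →* GL (Fin n) (Fbar p)) (s : ℤ) :
    ContainsConjugate (twist ρ s) = ContainsConjugate ρ := by
  ext L
  refine and_congr_right ?_
  rintro ⟨S, rfl⟩
  simp only [twist_mem_stdLevi_iff]

lemma LandsInMinimal.twist {ρ : GQ →* GL (Fin n) (Fbar p)} {S : Setoid (Fin n)}
    (h : LandsInMinimal ρ S) (s : ℤ) : LandsInMinimal (twist ρ s) S := by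
  refine ⟨fun σ => ?_, by rw [containsConjugate_twist]; exact h.2⟩
  exact mul_mem (scalar_mem_stdLevi S _) (h.1 σ)

lemma isConj_mul_self {φ : Qbar →+* ℂ} {c : GQ} (hc : NumberField.ComplexEmbedding.IsConj φ c) :
    c * c = 1 := by
  ext x
  apply φ.injective
  have h := fun y => RingHom.congr_fun hc y
  have h1 := h (c x)
  have h2 := h x
  simp only [NumberField.ComplexEmbedding.conjugate_coe_eq, RingHom.coe_comp,
    Function.comp_apply] at h1 h2
  have h1' : starRingEnd ℂ (φ (c x)) = φ (c (c x)) := h1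
  have h2' : starRingEnd ℂ (φ x) = φ (c x) := h2
  change φ (c (c x)) = φ x
  rw [← h1', ← h2', Complex.conj_conj]

lemma StrictParity.twist {ρ : GQ →* GL (Fin n) (Fbar p)} {S : Setoid (Fin n)}
    (h : StrictParity ρ S) (s : ℤ) : StrictParity (twist ρ s) S := by
  refine ⟨h.1.twist s, fun φ c hc => ?_⟩
  obtain ⟨g, hg, e, he, heq⟩ := h.2 φ c hc
  -- Complex conjugation is an involution, so `ω(c)^s` squares to one; it is then absorbed by the
  -- sign `e`.
  have hu : ((cyclo p c ^ s : (Fbar p)ˣ) : Fbar p) = 1 ∨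
      ((cyclo p c ^ s : (Fbar p)ˣ) : Fbar p) = -1 := by
    rw [← sq_eq_one_iff, ← Units.val_pow_eq_pow_val, ← zpow_natCast, ← zpow_mul, mul_comm,
      zpow_mul, zpow_natCast, sq, ← map_mul, isConj_mul_self hc, map_one, one_zpow, Units.val_one]
  refine ⟨g, hg, ((cyclo p c ^ s : (Fbar p)ˣ) : Fbar p) * e, ?_, ?_⟩
  · rcases hu with hu | hu <;> rcases he with he | he <;> simp [hu, he]
  · rw [twist_apply, ← mul_assoc g, scalar_mul_comm, mul_assoc, mul_assoc, ← mul_assoc g,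
      coe_scalar_mul, heq, ← Matrix.diagonal_smul]
    congr 1
    ext i
    simp [mul_assoc]

/-! ## The cyclotomic character on roots of unity -/

lemma exists_primitiveRoot (p : ℕ) [Fact p.Prime] : ∃ ζ : 𝓞 Qbar, IsPrimitiveRoot ζ p := by
  obtain ⟨ζ, hζ⟩ := HasEnoughRootsOfUnity.exists_primitiveRoot Qbar p
  exact ⟨hζ.toInteger, hζ.toInteger_isPrimitiveRoot⟩

lemma smul_eq_pow_cyclo {ζ : 𝓞 Qbar} (hζ : ζ ^ p = 1) (σ : GQ) :
    ∃ a : ℕ, σ • ζ = ζ ^ a ∧ (cyclo p σ : Fbar p) = a := by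
  have hu : IsUnit (ζ : Qbar) := by
    refine IsUnit.of_pow_eq_one (n := p) ?_ (Fact.out : p.Prime).ne_zero
    exact_mod_cast congrArg (algebraMap (𝓞 Qbar) Qbar) hζ
  have hmem : hu.unit ∈ rootsOfUnity p Qbar := by
    rw [mem_rootsOfUnity]
    ext
    simpa using congrArg (algebraMap (𝓞 Qbar) Qbar) hζ
  have hcard := HasEnoughRootsOfUnity.natCard_rootsOfUnity Qbar p
  have h := modularCyclotomicCharacter.spec Qbar hcard
    (MulSemiringAction.toRingAut GQ Qbar σ) hmem
  refine ⟨((modularCyclotomicCharacter Qbar hcard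
    (MulSemiringAction.toRingAut GQ Qbar σ) : (ZMod p)ˣ) : ZMod p).val,
    NumberField.RingOfIntegers.ext h, ?_⟩
  rw [← map_natCast (algebraMap (ZMod p) (Fbar p)), ZMod.natCast_zmod_val]
  rfl

/-- The action on `p`-th roots of unity determines the cyclotomic character. -/
lemma cyclo_eq_of_smul_eq {ζ : 𝓞 Qbar} (hζ : IsPrimitiveRoot ζ p) {σ : GQ} {a : ℕ}
    (h : σ • ζ = ζ ^ a) : (cyclo p σ : Fbar p) = a := by
  obtain ⟨b, hb, hc⟩ := smul_eq_pow_cyclo hζ.pow_eq_one σ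
  rw [hc, CharP.natCast_eq_natCast (Fbar p) p, hζ.eq_orderOf]
  have hu := hζ.isUnit (Fact.out : p.Prime).ne_zero
  have h2 : hu.unit ^ b = hu.unit ^ a := by
    ext1
    simp [← hb, h]
  rwa [pow_eq_pow_iff_modEq, ← orderOf_units, hu.unit_spec] at h2

lemma cyclo_eq_one_iff {ζ : 𝓞 Qbar} (hζ : IsPrimitiveRoot ζ p) {σ : GQ} :
    cyclo p σ = 1 ↔ σ • ζ = ζ := by
  refine ⟨fun h => ?_, fun h => ?_⟩
  · obtain ⟨a, ha, hc⟩ := smul_eq_pow_cyclo hζ.pow_eq_one σ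
    rw [h, Units.val_one, ← Nat.cast_one, CharP.natCast_eq_natCast (Fbar p) p,
      hζ.eq_orderOf] at hc
    rw [ha, ← pow_mod_orderOf, ← hc, pow_mod_orderOf, pow_one]
  · ext
    simpa using cyclo_eq_of_smul_eq (a := 1) hζ (by simpa using h)

/-- If `x ≠ 1`, then `1 + x + ... + x^(m-1) = 0`; but modulo `I` this sum is `m`. -/
lemma eq_one_of_pow_eq_one_of_sub_one_mem {R : Type*} [CommRing R] [IsDomain R] {I : Ideal R}
    {x : R} {m : ℕ} (hx : x ^ m = 1) (hm : (m : R) ∉ I) (h : x - 1 ∈ I) : x = 1 := by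
  by_contra hne
  have h0 : ∑ i ∈ Finset.range m, x ^ i = 0 := by
    have := geom_sum_mul x m
    rw [hx, sub_self, mul_eq_zero, sub_eq_zero] at this
    exact this.resolve_right hne
  apply hm
  have h1 : Ideal.Quotient.mk I x = 1 := by
    rw [← map_one (Ideal.Quotient.mk I), Ideal.Quotient.eq]; exact h
  have := congrArg (Ideal.Quotient.mk I) h0
  rw [map_sum] at this
  simp only [map_pow, h1, one_pow, Finset.sum_const, Finset.card_range, nsmul_eq_mul, mul_one,
    map_zero] at this
  rwa [← Ideal.Quotient.eq_zero_iff_mem, map_natCast]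

lemma IsPrimeAbove.natCast_notMem {q : ℕ} {𝔮 : Ideal (𝓞 Qbar)} (h : IsPrimeAbove q 𝔮)
    {m : ℕ} (hm : q.Coprime m) : (m : 𝓞 Qbar) ∉ 𝔮 := by
  intro hmem
  obtain ⟨a, b, hab⟩ := Nat.isCoprime_iff_coprime.2 hm
  apply h.1.ne_top
  rw [Ideal.eq_top_iff_one]
  have h1 : ((a * q + b * m : ℤ) : 𝓞 Qbar) = 1 := by rw [hab]; simp
  rw [← h1]
  push_cast
  exact add_mem (Ideal.mul_mem_left _ _ h.2) (Ideal.mul_mem_left _ _ hmem)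

/-- An automorphism which is trivial modulo a prime not dividing `m` fixes `m`-th roots of unity. -/
lemma smul_eq_self_of_pow_eq_one {G R : Type*} [Group G] [CommRing R] [IsDomain R]
    [MulSemiringAction G R] {I : Ideal R} {z : R} {m : ℕ} (hz : z ^ m = 1) (hm : (m : R) ∉ I)
    {g : G} (hg : g • z - z ∈ I) : g • z = z := by
  have hm0 : m ≠ 0 := fun h => hm (by simp [h])
  have hinv : z ^ (m - 1) * z = 1 := by
    rw [← pow_succ, Nat.sub_add_cancel (Nat.one_le_iff_ne_zero.2 hm0), hz]
  have h1 : z ^ (m - 1) * g • z = 1 := by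
    refine eq_one_of_pow_eq_one_of_sub_one_mem (m := m) (I := I) ?_ hm ?_
    · rw [mul_pow, ← smul_pow', hz, smul_one, ← pow_mul, mul_comm (m - 1), pow_mul, hz]; simp
    · have := Ideal.mul_mem_left I (z ^ (m - 1)) hg
      rwa [mul_sub, hinv] at this
  calc g • z = (z ^ (m - 1) * z) * g • z := by rw [hinv, one_mul]
    _ = z * (z ^ (m - 1) * g • z) := by ring
    _ = z := by rw [h1, mul_one]

lemma cyclo_eq_one_of_mem_inert {q : ℕ} (hq : q.Coprime p) {𝔮 : Ideal (𝓞 Qbar)}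
    (h𝔮 : IsPrimeAbove q 𝔮) {σ : GQ} (hσ : σ ∈ inert 𝔮) : cyclo p σ = 1 := by
  obtain ⟨ζ, hζ⟩ := exists_primitiveRoot p
  exact (cyclo_eq_one_iff hζ).2
    (smul_eq_self_of_pow_eq_one hζ.pow_eq_one (h𝔮.natCast_notMem hq) (hσ ζ))

/-! ## Fundamental characters -/

/-- Evaluating the `p`-th cyclotomic polynomial at one gives `p = ∏ (1 - ζ^k)` over `0 < k < p`, and
every factor is a unit times `ζ - 1`. -/
lemma associated_prime_sub_one_pow {R : Type*} [CommRing R] [IsDomain R] {ζ : R}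
    (hζ : IsPrimitiveRoot ζ p) : Associated (p : R) ((ζ - 1) ^ (p - 1)) := by
  have hp := (Fact.out : p.Prime)
  have hp1 : p - 1 + 1 = p := Nat.sub_add_cancel hp.one_le
  have h := IsPrimitiveRoot.prod_one_sub_pow_eq_order (n := p - 1) (μ := ζ) (by rwa [hp1])
  rw [← Nat.cast_add_one, hp1] at h
  rw [← h]
  have h2 : ((ζ - 1) ^ (p - 1)) = ∏ _k ∈ Finset.range (p - 1), (ζ - 1) := by simp
  rw [h2]
  refine Associated.prod _ _ _ fun k hk => ?_
  have hk' : k + 1 < p := by have := Finset.mem_range.1 hk; omega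
  rw [← neg_sub]
  refine Associated.neg_left (hζ.associated_sub_one_pow_sub_one_of_coprime ?_).symm
  exact (Nat.coprime_of_lt_prime (Nat.succ_ne_zero k) hk' hp).symm

/-- The norm from niveau `d` to niveau `1` of a fundamental character is the cyclotomic
character. -/
lemma IsFundamentalCharacter.pow_eq_cyclo {𝔓 : Ideal (𝓞 Qbar)} (h𝔓 : IsPrimeAbove p 𝔓) {d : ℕ}
    {ψ : inert 𝔓 →* (Fbar p)ˣ} (hψ : IsFundamentalCharacter 𝔓 d ψ)
    (τ : inert 𝔓) : ψ τ ^ (∑ r ∈ Finset.range d, p ^ r) = cyclo p τ := by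
  obtain ⟨ι, ϖ, hϖ, hu⟩ := hψ
  obtain ⟨u, hτϖ, hψu⟩ := hu τ
  obtain ⟨ζ, hζ⟩ := exists_primitiveRoot p
  have hp := (Fact.out : p.Prime)
  have hp1 : p - 1 ≠ 0 := Nat.sub_ne_zero_of_lt hp.one_lt
  set E := ∑ r ∈ Finset.range d, p ^ r with hE
  have hEp : E * (p - 1) = p ^ d - 1 := by
    rw [hE, Nat.geomSum_eq hp.two_le, Nat.div_mul_cancel (Nat.sub_one_dvd_pow_sub_one p d)]
  -- As `E (p - 1) = p^d - 1`, the element `ϖ^E` is a `(p-1)`-st root of `p`; it is now compared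
  -- with `ζ - 1`, another such root up to a unit.
  have hπ : (ϖ ^ E) ^ (p - 1) = (p : 𝓞 Qbar) := by rw [← pow_mul, hEp, hϖ]
  have hp0 : (p : 𝓞 Qbar) ≠ 0 := Nat.cast_ne_zero.2 hp.ne_zero
  have hπ0 : ϖ ^ E ≠ 0 := fun h => hp0 (by rw [← hπ, h, zero_pow hp1])
  obtain ⟨v, hv⟩ := associated_prime_sub_one_pow hζ
  -- The quotient of `ζ - 1` by `ϖ^E` is integral because its `(p-1)`-st power is the unit `v`.
  obtain ⟨w, hw⟩ : ∃ w : 𝓞 Qbar, ζ - 1 = w * ϖ ^ E := by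
    have hπ0' : ((ϖ ^ E : 𝓞 Qbar) : Qbar) ≠ 0 := by
      rwa [Ne, NumberField.RingOfIntegers.coe_eq_zero_iff]
    have hint : IsIntegral ℤ (((ζ - 1 : 𝓞 Qbar) : Qbar) / ((ϖ ^ E : 𝓞 Qbar) : Qbar)) := by
      refine IsIntegral.of_pow (Nat.pos_of_ne_zero hp1) ?_
      have : (((ζ - 1 : 𝓞 Qbar) : Qbar) / ((ϖ ^ E : 𝓞 Qbar) : Qbar)) ^ (p - 1) =
          ((v : 𝓞 Qbar) : Qbar) := by
        rw [div_pow, div_eq_iff (pow_ne_zero _ hπ0'), ← map_pow, ← map_pow, ← map_mul, hπ, ← hv,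
          mul_comm]
      rw [this]
      exact NumberField.RingOfIntegers.isIntegral_coe _
    exact ⟨⟨_, hint⟩, NumberField.RingOfIntegers.ext (div_mul_cancel₀ _ hπ0').symm⟩
  have hwunit : w ^ (p - 1) = v := by
    have : w ^ (p - 1) * p = v * p := by rw [← hπ, ← mul_pow, ← hw, hπ, ← hv, mul_comm]
    exact mul_right_cancel₀ hp0 this
  obtain ⟨a, ha, hcyc⟩ := smul_eq_pow_cyclo hζ.pow_eq_one (τ : GQ)
  -- Two computations of `τ(ζ - 1)`: through `w ϖ^E`, and as `ζ^a - 1`, a geometric sum times `ζ -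
  -- 1`. Modulo `𝔓` the geometric sum becomes `a`, since `ζ ≡ 1`.
  have key : (τ : GQ) • w * u ^ E = (∑ i ∈ Finset.range a, ζ ^ i) * w := by
    refine mul_right_cancel₀ hπ0 ?_
    rw [mul_assoc _ w, ← hw, geom_sum_mul, mul_assoc, ← mul_pow, ← hτϖ, ← smul_pow', ← smul_mul',
      ← hw, smul_sub, smul_one, ha]
  have hζ1 : Ideal.Quotient.mk 𝔓 ζ = 1 := by
    rw [← map_one (Ideal.Quotient.mk 𝔓), Ideal.Quotient.eq]
    refine h𝔓.1.mem_of_pow_mem (p - 1) ?_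
    rw [← hv]
    exact Ideal.mul_mem_right _ _ h𝔓.2
  -- Inertia fixes `w` modulo `𝔓`, and `w` is a unit, so it cancels and leaves `u^E ≡ a`.
  have hτw : Ideal.Quotient.mk 𝔓 ((τ : GQ) • w) = Ideal.Quotient.mk 𝔓 w :=
    Ideal.Quotient.eq.2 (τ.2 w)
  have key2 := congrArg (fun x => ι (Ideal.Quotient.mk 𝔓 x)) key
  simp only [map_mul, map_pow, map_sum, hτw, hζ1, one_pow, Finset.sum_const,
    Finset.card_range, nsmul_eq_mul, mul_one, map_natCast] at key2
  have hw1 : IsUnit w := (isUnit_pow_iff hp1).1 (hwunit ▸ v.isUnit)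
  have hw0 : ι (Ideal.Quotient.mk 𝔓 w) ≠ 0 := (hw1.map (ι.comp (Ideal.Quotient.mk 𝔓))).ne_zero
  ext
  rw [Units.val_pow_eq_pow_val, hψu, hcyc]
  refine mul_left_cancel₀ hw0 ?_
  rw [key2, mul_comm]

/-! ## Derived tuples -/

/-- Adding `s` to every digit adds `s (1 + q + ... + q^(d-1))` to the number, and the conditions on
the digits involve only their differences and order. -/
lemma IsDigitTuple.add_const {q d : ℕ} {m : ℤ} {b : Fin d → ℤ} (h : IsDigitTuple q d m b)
    (s : ℤ) :
    IsDigitTuple q d (m + s * ((∑ r ∈ Finset.range d, q ^ r : ℕ) : ℤ)) (fun i => b i + s) := by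
  obtain ⟨α, hm, hα, hb, π, rfl⟩ := h
  refine ⟨fun r => α r + s, ?_, fun r t ht => ?_, fun i j hij => ?_, π, rfl⟩
  · rw [hm, Finset.sum_range]
    push_cast
    simp only [add_mul, Finset.sum_add_distrib, Finset.mul_sum]
  · simpa using hα r t ht
  · simpa using hb hij

lemma isDecompStable_twist_iff {ρ : GQ →* GL (Fin n) (Fbar p)} (s : ℤ) {𝔓 : Ideal (𝓞 Qbar)}
    {U : Submodule (Fbar p) (Fin n → Fbar p)} :
    IsDecompStable (twist ρ s) 𝔓 U ↔ IsDecompStable ρ 𝔓 U := by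
  refine forall₄_congr fun g _ v _ => ?_
  rw [galRep_twist, Submodule.smul_mem_iff _ (Units.ne_zero _)]

/-- The same basis, composition series and permutation serve for the twist. Only the inertia
characters change, by `ω^s`, which `IsFundamentalCharacter.pow_eq_cyclo` rewrites as the power of
`ψ` that `IsDigitTuple.add_const` requires. -/
lemma IsDerivedFromSpace.twist {ρ : GQ →* GL (Fin n) (Fbar p)} {𝔓 : Ideal (𝓞 Qbar)}
    (h𝔓 : IsPrimeAbove p 𝔓) {D : Submodule (Fbar p) (Fin n → Fbar p)} {d : ℕ} {a : Fin d → ℤ}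
    (h : IsDerivedFromSpace ρ 𝔓 D a) (s : ℤ) :
    IsDerivedFromSpace (twist ρ s) 𝔓 D (fun i => a i + s) := by
  obtain ⟨e, c, φ, a₀, σ, hli, hspan, hstab, hsimple, hdiag, hdig, hmono, htri, ha⟩ := h
  refine ⟨e, c, fun j τ => ((cyclo p τ ^ s : (Fbar p)ˣ) : Fbar p) * φ j τ, fun j => a₀ j + s, σ,
    hli, hspan, ?_, ?_, ?_, ?_, hmono, ?_, fun j => congrArg (· + s) (ha j)⟩
  · simpa only [isDecompStable_twist_iff] using hstab
  · simpa only [isDecompStable_twist_iff] using hsimple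
  · intro t x τ
    rw [galRep_twist, mul_smul, ← smul_sub]
    exact Submodule.smul_mem _ _ (hdiag t x τ)
  · intro t
    obtain ⟨m, ψ, hψ, ⟨x, hx⟩, hm⟩ := hdig t
    refine ⟨_, ψ, hψ, ⟨x, fun τ => ?_⟩, hm.add_const s⟩
    change _ * φ _ τ = _
    rw [hx, mul_comm s, zpow_add, zpow_mul, zpow_natCast, hψ.pow_eq_cyclo h𝔓, mul_comm,
      Units.val_mul]
  · intro τ j
    rw [galRep_twist]
    exact Submodule.smul_mem _ _ (htri τ j)

lemma IsDerivedTuple.twist {ρ : GQ →* GL (Fin n) (Fbar p)} {𝔓 : Ideal (𝓞 Qbar)}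
    (h𝔓 : IsPrimeAbove p 𝔓) {S : Setoid (Fin n)} {a : Fin n → ℤ}
    (h : IsDerivedTuple ρ 𝔓 S a) (s : ℤ) :
    IsDerivedTuple (twist ρ s) 𝔓 S (fun i => a i + s) :=
  ⟨h.1.twist s, fun i => (h.2 i).twist h𝔓 s⟩

lemma isDerivedTuple_twist_iff {ρ : GQ →* GL (Fin n) (Fbar p)} {𝔓 : Ideal (𝓞 Qbar)}
    (h𝔓 : IsPrimeAbove p 𝔓) {S : Setoid (Fin n)} {a : Fin n → ℤ} (s : ℤ) :
    IsDerivedTuple (twist ρ s) 𝔓 S (fun i => a i + s) ↔ IsDerivedTuple ρ 𝔓 S a := by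
  refine ⟨fun h => ?_, fun h => h.twist h𝔓 s⟩
  simpa only [twist_twist_neg, add_neg_cancel_right] using h.twist h𝔓 (-s)

/-! ## Twisting weights by powers of the determinant -/

/-- Multiplication by `det ^ t`, as an automorphism of the space of functions on `GL_n`. -/
def mulDet (p n : ℕ) [Fact p.Prime] (t : ℤ) :
    (GL (Fin n) (Fbar p) → Fbar p) ≃ₗ[Fbar p] (GL (Fin n) (Fbar p) → Fbar p) :=
  LinearEquiv.piCongrRight fun g => LinearEquiv.smulOfUnit (Matrix.GeneralLinearGroup.det g ^ t)

lemma mulDet_apply (t : ℤ) (f : GL (Fin n) (Fbar p) → Fbar p) (g : GL (Fin n) (Fbar p)) :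
    mulDet p n t f g = (g : Matrix (Fin n) (Fin n) (Fbar p)).det ^ t * f g := by
  have : mulDet p n t f g = (Matrix.GeneralLinearGroup.det g ^ t) • f g := rfl
  rw [this, Units.smul_def, Units.val_zpow_eq_zpow_val]
  rfl

lemma mulDet_neg_mulDet (t : ℤ) (f : GL (Fin n) (Fbar p) → Fbar p) :
    mulDet p n (-t) (mulDet p n t f) = f := by
  ext g
  have h0 : (g : Matrix (Fin n) (Fin n) (Fbar p)).det ≠ 0 := g.det_ne_zero
  rw [mulDet_apply, mulDet_apply, ← mul_assoc, ← zpow_add₀ h0, neg_add_cancel, zpow_zero, one_mul]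

/-- Equivariance holds only up to the scalar `det(h)^t`. This is enough to send subrepresentations
to subrepresentations, and the scalar itself is the twist by the determinant. -/
lemma translation_mulDet (t : ℤ) (h : GL (Fin n) (Fbar p)) (f : GL (Fin n) (Fbar p) → Fbar p) :
    translation p n h (mulDet p n t f) =
      (h : Matrix (Fin n) (Fin n) (Fbar p)).det ^ t • mulDet p n t (translation p n h f) := by
  ext g
  change mulDet p n t f (g * h) = _
  rw [Pi.smul_apply, mulDet_apply, mulDet_apply, Units.val_mul, Matrix.det_mul, mul_zpow]
  change _ = _ • (_ * f (g * h))
  rw [smul_eq_mul]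
  ring

lemma det_mem_regularFunctions :
    (fun g : GL (Fin n) (Fbar p) => (g : Matrix (Fin n) (Fin n) (Fbar p)).det) ∈
      regularFunctions p n := by
  have : (fun g : GL (Fin n) (Fbar p) => (g : Matrix (Fin n) (Fin n) (Fbar p)).det) =
      ∑ σ : Equiv.Perm (Fin n), (Equiv.Perm.sign σ : ℤ) • ∏ i,
        fun g : GL (Fin n) (Fbar p) => (g : Matrix (Fin n) (Fin n) (Fbar p)) (σ i) i := by
    ext g
    rw [Matrix.det_apply', Finset.sum_apply]
    refine Finset.sum_congr rfl fun σ _ => ?_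
    rw [Pi.smul_apply, Finset.prod_apply, zsmul_eq_mul]
  rw [this]
  refine Subalgebra.sum_mem _ fun σ _ => zsmul_mem (Subalgebra.prod_mem _ fun i _ => ?_) _
  exact Algebra.subset_adjoin (Or.inl ⟨(σ i, i), rfl⟩)

lemma det_zpow_mem_regularFunctions (t : ℤ) :
    (fun g : GL (Fin n) (Fbar p) => (g : Matrix (Fin n) (Fin n) (Fbar p)).det ^ t) ∈
      regularFunctions p n := by
  cases t with
  | ofNat k => simpa using! Subalgebra.pow_mem _ det_mem_regularFunctions k
  | negSucc k =>
    have : (fun g : GL (Fin n) (Fbar p) => ((g : Matrix (Fin n) (Fin n) (Fbar p)).det)⁻¹) ∈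
      regularFunctions p n := Algebra.subset_adjoin (Or.inr rfl)
    have := Subalgebra.pow_mem _ this (k + 1)
    convert this using 1
    ext g
    simp [zpow_negSucc]

/-- The determinant of a lower triangular `β` is the product of its diagonal entries, so the factor
`det^t` raises each exponent by `t`. -/
lemma mulDet_mem_dualWeyl {b : Fin n → ℤ} (t : ℤ) {f : GL (Fin n) (Fbar p) → Fbar p}
    (hf : f ∈ dualWeyl p b) : mulDet p n t f ∈ dualWeyl p (fun i => b i + t) := by
  refine ⟨?_, fun β g hβ => ?_⟩
  · have := Subalgebra.mul_mem _ (det_zpow_mem_regularFunctions (p := p) (n := n) t) hf.1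
    convert this using 1
    ext g
    rw [mulDet_apply]
    rfl
  · have hdet : (β : Matrix (Fin n) (Fin n) (Fbar p)).det =
        ∏ i, (β : Matrix (Fin n) (Fin n) (Fbar p)) i i :=
      Matrix.det_of_isLowerTriangular _ fun i j hij => hβ i j hij
    have h0 : ∀ i, (β : Matrix (Fin n) (Fin n) (Fbar p)) i i ≠ 0 := fun i hi => by
      apply β.det_ne_zero
      rw [hdet]
      exact Finset.prod_eq_zero (Finset.mem_univ i) hi
    have hprod : (∏ i, (β : Matrix (Fin n) (Fin n) (Fbar p)) i i ^ (b i + t)) =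
        (∏ i, (β : Matrix (Fin n) (Fin n) (Fbar p)) i i ^ b i) *
          (β : Matrix (Fin n) (Fin n) (Fbar p)).det ^ t := by
      rw [hdet, ← Finset.prod_zpow, ← Finset.prod_mul_distrib]
      exact Finset.prod_congr rfl fun i _ => zpow_add₀ (h0 i) _ _
    rw [mulDet_apply, mulDet_apply, hf.2 β g hβ, Units.val_mul, Matrix.det_mul, mul_zpow, hprod]
    ring

/-- The image of a subrepresentation under multiplication by `det ^ t`. -/
def mapMulDet (t : ℤ) (U : Subrepresentation (translation p n)) :
    Subrepresentation (translation p n) where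
  toSubmodule := U.toSubmodule.map (mulDet p n t).toLinearMap
  apply_mem_toSubmodule := by
    rintro h _ ⟨f, hf, rfl⟩
    rw [LinearEquiv.coe_coe, translation_mulDet]
    exact Submodule.smul_mem _ _ ⟨_, U.apply_mem_toSubmodule h hf, rfl⟩

lemma mapMulDet_neg_mapMulDet (t : ℤ) (U : Subrepresentation (translation p n)) :
    mapMulDet (-t) (mapMulDet t U) = U := by
  apply Subrepresentation.toSubmodule_injective
  change (U.toSubmodule.map (mulDet p n t).toLinearMap).map (mulDet p n (-t)).toLinearMap = _
  rw [← Submodule.map_comp]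
  convert Submodule.map_id _
  ext1 f
  exact mulDet_neg_mulDet t f

/-- `mapMulDet` as an automorphism of the lattice of subrepresentations. -/
def mapMulDetIso (t : ℤ) :
    Subrepresentation (translation p n) ≃o Subrepresentation (translation p n) where
  toFun := mapMulDet t
  invFun := mapMulDet (-t)
  left_inv := mapMulDet_neg_mapMulDet t
  right_inv U := by simpa using mapMulDet_neg_mapMulDet (-t) U
  map_rel_iff' {_ _} := Submodule.map_le_map_iff_of_injective (mulDet p n t).injective _ _

/-- An automorphism of the lattice of subrepresentations preserves atoms, and this one moves the
dual Weyl module for `b` into the one for `b + t`. -/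
lemma map_simpleSub_le (b : Fin n → ℤ) (t : ℤ) :
    (simpleSub p b).toSubmodule.map (mulDet p n t).toLinearMap ≤
      (simpleSub p (fun i => b i + t)).toSubmodule := by
  change (⨆ U : {U : Subrepresentation (translation p n) //
    IsAtom U ∧ U.toSubmodule ≤ dualWeyl p b}, U.1.toSubmodule).map _ ≤ _
  rw [Submodule.map_iSup]
  refine iSup_le fun U => ?_
  refine le_iSup (fun U : {U : Subrepresentation (translation p n) //
    IsAtom U ∧ U.toSubmodule ≤ dualWeyl p (fun i => b i + t)} => U.1.toSubmodule)
      ⟨mapMulDetIso t U.1, (OrderIso.isAtom_iff (mapMulDetIso t) _).2 U.2.1, ?_⟩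
  rintro _ ⟨f, hf, rfl⟩
  exact mulDet_mem_dualWeyl t (U.2.2 hf)

lemma map_simpleSub (b : Fin n → ℤ) (t : ℤ) :
    (simpleSub p b).toSubmodule.map (mulDet p n t).toLinearMap =
      (simpleSub p (fun i => b i + t)).toSubmodule := by
  refine le_antisymm (map_simpleSub_le b t) fun f hf => ?_
  have h := map_simpleSub_le (p := p) (fun i => b i + t) (-t) ⟨f, hf, rfl⟩
  simp only [add_neg_cancel_right] at h
  refine ⟨_, h, ?_⟩
  simpa using mulDet_neg_mulDet (-t) f

/-- Multiplication by `det ^ t` on `F(b)`. -/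
def weightTwist (p : ℕ) [Fact p.Prime] (b : Fin n → ℤ) (t : ℤ) :
    WeightSpace p b ≃ₗ[Fbar p] WeightSpace p (fun i => b i + t) :=
  ((mulDet p n t).submoduleMap (simpleSub p b).toSubmodule).trans
    (LinearEquiv.ofEq _ _ (map_simpleSub b t))

/-- Fermat's little theorem. It allows the shift `t` of a highest weight to differ from the twist
`s` by a multiple of `p - 1`. -/
lemma zpow_eq_zpow_of_modEq (u : (ZMod p)ˣ) {s t : ℤ} (h : s ≡ t [ZMOD (p : ℤ) - 1]) :
    u ^ s = u ^ t := by
  obtain ⟨k, hk⟩ := h.dvd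
  have hp : ((p - 1 : ℕ) : ℤ) = (p : ℤ) - 1 := by
    rw [Nat.cast_sub (Fact.out : p.Prime).one_le, Nat.cast_one]
  have h1 : u ^ ((p : ℤ) - 1) = 1 := by rw [← hp, zpow_natCast, ZMod.units_pow_card_sub_one_eq_one]
  rw [eq_add_of_sub_eq hk, zpow_add, zpow_mul, h1, one_zpow, one_mul]

/-- The scalar in `𝔽̄_p` by which `g` acts on `det ^ s`. -/
def detScalar (s : ℤ) (g : GL (Fin n) (ZMod p)) : Fbar p :=
  algebraMap (ZMod p) (Fbar p) ((Matrix.GeneralLinearGroup.det g ^ s : (ZMod p)ˣ) : ZMod p)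

lemma detRep_apply (s : ℤ) (g : GL (Fin n) (ZMod p)) (x : Fbar p) :
    detRep p n s g x = detScalar s g * x := rfl

lemma weightRep_weightTwist (b : Fin n → ℤ) {s t : ℤ} (hst : s ≡ t [ZMOD (p : ℤ) - 1])
    (g : GL (Fin n) (ZMod p)) (f : WeightSpace p b) :
    weightRep p (fun i => b i + t) g (weightTwist p b t f) =
      detScalar s g • weightTwist p b t (weightRep p b g f) := by
  apply Subtype.ext
  change translation p n (Matrix.GeneralLinearGroup.map (algebraMap (ZMod p) (Fbar p)) g)
    (mulDet p n t f) = detScalar s g • mulDet p n t (translation p n _ f)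
  rw [translation_mulDet]
  congr 1
  have h : ((Matrix.GeneralLinearGroup.map (algebraMap (ZMod p) (Fbar p)) g :
      GL (Fin n) (Fbar p)) : Matrix (Fin n) (Fin n) (Fbar p)).det =
      algebraMap (ZMod p) (Fbar p) (g : Matrix (Fin n) (Fin n) (ZMod p)).det :=
    (RingHom.map_det (algebraMap (ZMod p) (Fbar p)) _).symm
  rw [h, detScalar, zpow_eq_zpow_of_modEq _ hst, Units.val_zpow_eq_zpow_val, map_zpow₀]
  rfl

/-- Twisting the highest weight by a constant tensors the weight with a power of the
determinant. -/
lemma nonempty_weightRep_equiv (b : Fin n → ℤ) {s t : ℤ} (hst : s ≡ t [ZMOD (p : ℤ) - 1]) :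
    Nonempty ((weightRep p (fun i => b i + t)).Equiv ((weightRep p b).tprod (detRep p n s))) := by
  refine ⟨Representation.Equiv.symm (Representation.Equiv.mk
    ((TensorProduct.rid (Fbar p) _).trans (weightTwist p b t)) fun g => ?_)⟩
  refine TensorProduct.ext' fun f x => ?_
  simp only [LinearMap.comp_apply, LinearEquiv.coe_coe, LinearEquiv.trans_apply,
    Representation.tprod_apply, TensorProduct.map_tmul, TensorProduct.rid_tmul, map_smul,
    weightRep_weightTwist b hst, detRep_apply]
  rw [smul_smul, mul_comm]

/-! ### Restricted representatives of shifted tuples -/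

section

variable [NeZero n]

lemma IsPrimed.add_const {a b : Fin n → ℤ} (h : IsPrimed p a b) (s : ℤ) :
    ∃ t : ℤ, s ≡ t [ZMOD (p : ℤ) - 1] ∧ IsPrimed p (fun i => a i + s) (fun i => b i + t) := by
  have hp : (0 : ℤ) < (p : ℤ) - 1 := by
    have := (Fact.out : p.Prime).two_le
    omega
  obtain ⟨⟨h1, -⟩, h2⟩ := h
  -- A constant shift preserves consecutive differences, so only the last entry can leave its range.
  -- The shift is chosen to replace `b_n + s` by its residue modulo `p - 1`.
  have hst : s ≡ (b (Fin.rev 0) + s) % ((p : ℤ) - 1) - b (Fin.rev 0) [ZMOD (p : ℤ) - 1] := by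
    have := ((Int.mod_modEq (b (Fin.rev 0) + s) ((p : ℤ) - 1)).sub_right (b (Fin.rev 0))).symm
    rwa [add_sub_cancel_left] at this
  refine ⟨(b (Fin.rev 0) + s) % ((p : ℤ) - 1) - b (Fin.rev 0), hst, ⟨?_, ?_, ?_⟩,
    fun i => (h2 i).add hst⟩
  · intro i j hij
    simpa using h1 i j hij
  · simpa using Int.emod_nonneg _ hp.ne'
  · simpa using Int.emod_lt_of_pos _ hp

lemma IsWeightOf.add_const {a b : Fin n → ℤ} (h : IsWeightOf p a b) (s : ℤ) :
    ∃ t : ℤ, s ≡ t [ZMOD (p : ℤ) - 1] ∧ IsWeightOf p (fun i => a i + s) (fun i => b i + t) := by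
  obtain ⟨t, hst, ht⟩ := IsPrimed.add_const h s
  refine ⟨t, hst, ?_⟩
  have he : (fun i => a i + s - ((n : ℤ) - 1 - (i : ℕ))) =
      fun i => a i - ((n : ℤ) - 1 - (i : ℕ)) + s := by
    ext i
    ring
  rw [IsWeightOf, he]
  exact ht

end

/-! ## Frobenius elements and the cyclotomic character -/

lemma IsPrimeAbove.under_int {l : ℕ} (hl : l.Prime) {𝔩 : Ideal (𝓞 Qbar)}
    (h𝔩 : IsPrimeAbove l 𝔩) : 𝔩.under ℤ = Ideal.span {(l : ℤ)} := by
  have hmax : (Ideal.span {(l : ℤ)}).IsMaximal :=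
    PrincipalIdealRing.isMaximal_of_irreducible (Nat.prime_iff_prime_int.1 hl).irreducible
  have := h𝔩.1
  refine (hmax.eq_of_le (Ideal.IsPrime.ne_top inferInstance) ?_).symm
  rw [Ideal.span_singleton_le_iff_mem, Ideal.mem_comap]
  simpa using h𝔩.2

/-- A Frobenius at `𝔩` raises roots of unity of order prime to `l` to the power of the residue
cardinality of `ℤ` at `𝔩`, which is `l`. -/
lemma cyclo_of_isArithFrobAt {l : ℕ} (hl : l.Prime) (hlp : l.Coprime p) {𝔩 : Ideal (𝓞 Qbar)}
    (h𝔩 : IsPrimeAbove l 𝔩) {σ : GQ} (hσ : IsArithFrobAt ℤ σ 𝔩) :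
    (cyclo p σ : Fbar p) = l := by
  obtain ⟨ζ, hζ⟩ := exists_primitiveRoot p
  refine cyclo_eq_of_smul_eq hζ ?_
  have h := AlgHom.IsArithFrobAt.apply_of_pow_eq_one hσ hζ.pow_eq_one (h𝔩.natCast_notMem hlp)
  rwa [h𝔩.under_int hl, Nat.card_congr (Int.quotientSpanNatEquivZMod l).toEquiv,
    Nat.card_zmod] at h

lemma charpolyRev_smul {R : Type*} [CommRing R] {m : Type*} [Fintype m] [DecidableEq m] (c : R)
    (M : Matrix m m R) :
    (c • M).charpolyRev = M.charpolyRev.comp (Polynomial.C c * Polynomial.X) := by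
  rw [Matrix.charpolyRev, Matrix.charpolyRev, ← Polynomial.coe_compRingHom_apply,
    RingHom.map_det]
  congr 1
  ext1 i j
  simp only [Matrix.sub_apply, Matrix.smul_apply, Matrix.map_apply, smul_eq_mul, map_mul,
    RingHom.mapMatrix_apply, map_sub, Polynomial.coe_compRingHom_apply, Polynomial.X_comp,
    Polynomial.C_comp, Matrix.one_apply]
  split_ifs <;> simp <;> ring

lemma IsUnramifiedAt.twist {ρ : GQ →* GL (Fin n) (Fbar p)} {l : ℕ} (hlp : l.Coprime p)
    (h : IsUnramifiedAt ρ l) (s : ℤ) : IsUnramifiedAt (twist ρ s) l := by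
  intro 𝔩 h𝔩 τ hτ
  rw [twist_eq_of_cyclo_eq_one _ _ (cyclo_eq_one_of_mem_inert hlp h𝔩 hτ), h 𝔩 h𝔩 τ hτ]

/-! ## Twisting cohomology classes -/

lemma detScalar_mul (s : ℤ) (g h : GL (Fin n) (ZMod p)) :
    detScalar s (g * h) = detScalar s g * detScalar s h := by
  simp only [detScalar, map_mul, mul_zpow, Units.val_mul]

/-! ### Functoriality of group cohomology in the coefficients -/

section CohomologyMap

open CategoryTheory

variable {k G : Type} [CommRing k] [Group G] {A B : Rep k G}

lemma iCocycles_cocyclesMap_apply (φ : A ⟶ B) (i : ℕ) (z : groupCohomology.cocycles A i)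
    (g : Fin i → G) :
    groupCohomology.iCocycles B i (groupCohomology.cocyclesMap (MonoidHom.id G) φ i z) g =
      φ.hom (groupCohomology.iCocycles A i z g) :=
  congrFun (ConcreteCategory.congr_hom (HomologicalComplex.cyclesMap_i
    (groupCohomology.cochainsMap (MonoidHom.id G) φ) i) z) g

lemma functor_map_π_apply (φ : A ⟶ B) (i : ℕ) (z : groupCohomology.cocycles A i) :
    (groupCohomology.functor k G i).map φ (groupCohomology.π A i z) =
      groupCohomology.π B i (groupCohomology.cocyclesMap (MonoidHom.id G) φ i z) :=
  ConcreteCategory.congr_hom (groupCohomology.π_map (A := A) (B := B) (MonoidHom.id G) φ i) z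

end CohomologyMap

/-! ### Hecke operators on coefficients twisted by the determinant -/

section Hecke

variable [NeZero n] {N : ℕ}

lemma coe_det_redModP (A : heckeMonoid p n N) :
    ((Matrix.GeneralLinearGroup.det (redModP A) : (ZMod p)ˣ) : ZMod p) = (A.1.det : ZMod p) :=
  (RingHom.map_det (Int.castRingHom (ZMod p)) A.1).symm

lemma detScalar_redModP (s : ℤ) (A : heckeMonoid p n N) :
    detScalar s (redModP A) = (A.1.det : Fbar p) ^ s := by
  rw [detScalar, Units.val_zpow_eq_zpow_val, map_zpow₀, coe_det_redModP, map_intCast]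

/-- `Γ_0(N)` has determinant one, so it does not see the twist: the cohomology groups are isomorphic
and only the Hecke operators are rescaled. -/
lemma detScalar_gammaIncl (s : ℤ) (γ : Gamma0 n N) :
    detScalar s (redModP (gammaIncl p γ)) = 1 := by
  rw [detScalar_redModP]
  have : (gammaIncl p γ).1.det = 1 := γ.1.2
  rw [this, Int.cast_one, one_zpow]

lemma det_heckeD {q l k : ℕ} (hl : l.Prime) (h : ¬ l ∣ q * N) (hk : k ≤ n) :
    (heckeD (n := n) l k hl h).1.det = (l : ℤ) ^ k := by
  change (Matrix.diagonal fun i : Fin n => if (i : ℕ) + k < n then 1 else (l : ℤ)).det = _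
  rw [Matrix.det_diagonal, Fin.prod_univ_eq_prod_range
    (fun i => if i + k < n then 1 else (l : ℤ)) n, Finset.prod_ite, Finset.prod_const_one, one_mul,
    Finset.prod_const]
  congr 1
  -- The indices carrying `l` are `n - k, ..., n - 1`; there are exactly `k` of them because `k ≤
  -- n`.
  have : (Finset.range n).filter (fun x => ¬ x + k < n) = Finset.Ico (n - k) n := by
    ext x
    simp only [Finset.mem_filter, Finset.mem_range, Finset.mem_Ico]
    omega
  rw [this, Nat.card_Ico]
  omega

variable {V V' : Type} [AddCommGroup V] [Module (Fbar p) V] [AddCommGroup V'] [Module (Fbar p) V']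
  {τ : Representation (Fbar p) (GL (Fin n) (ZMod p)) V}
  {τ' : Representation (Fbar p) (GL (Fin n) (ZMod p)) V'}
  {ε : DirichletCharacter (Fbar p) N}

/-- `f` identifies the module `V'` with `V ⊗ det ^ s`. -/
def IsDetTwist (τ : Representation (Fbar p) (GL (Fin n) (ZMod p)) V)
    (τ' : Representation (Fbar p) (GL (Fin n) (ZMod p)) V') (s : ℤ) (f : V ≃ₗ[Fbar p] V') : Prop :=
  ∀ g v, τ' g (f v) = detScalar s g • f (τ g v)

variable {s : ℤ} {f : V ≃ₗ[Fbar p] V'}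

lemma IsDetTwist.coeffRep_apply (hf : IsDetTwist τ τ' s f) (A : heckeMonoid p n N) (v : V) :
    coeffRep τ' ε A (f v) = detScalar s (redModP A) • f (coeffRep τ ε A v) := by
  change ε (A.1 0 0 : ZMod N) • τ' (redModP A) (f v) =
    _ • f (ε (A.1 0 0 : ZMod N) • τ (redModP A) v)
  rw [hf, map_smul, smul_comm]

lemma IsDetTwist.coeffRep_gammaIncl (hf : IsDetTwist τ τ' s f) (γ : Gamma0 n N) (v : V) :
    coeffRep τ' ε (gammaIncl p γ) (f v) = f (coeffRep τ ε (gammaIncl p γ) v) := by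
  rw [hf.coeffRep_apply, detScalar_gammaIncl, one_smul]

/-- The isomorphism of `Γ_0(N)`-modules given by a twist by a power of the determinant. -/
def IsDetTwist.repIso (hf : IsDetTwist τ τ' s f) (ε : DirichletCharacter (Fbar p) N) :
    gammaRep τ ε ≅ gammaRep τ' ε :=
  Rep.mkIso (Representation.Equiv.mk f fun γ => by
    ext v
    exact (hf.coeffRep_gammaIncl γ v).symm)

/-- The isomorphism in cohomology given by a twist by a power of the determinant. -/
def IsDetTwist.cohomologyIso (hf : IsDetTwist τ τ' s f) (ε : DirichletCharacter (Fbar p) N)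
    (i : ℕ) : groupCohomology (gammaRep τ ε) i ≅ groupCohomology (gammaRep τ' ε) i :=
  (groupCohomology.functor (Fbar p) (Gamma0 n N) i).mapIso (hf.repIso ε)

lemma IsDetTwist.isClassOf (hf : IsDetTwist τ τ' s f) {i : ℕ}
    {v : groupCohomology (gammaRep τ ε) i} {F : (Fin (i + 1) → GL (Fin n) ℚ) → V}
    (h : IsClassOf τ ε v F) :
    IsClassOf τ' ε ((hf.cohomologyIso ε i).hom v) (fun x => f (F x)) := by
  obtain ⟨z, hz, rfl⟩ := h
  refine ⟨groupCohomology.cocyclesMap (MonoidHom.id _) (hf.repIso ε).hom i z, fun g => ?_, ?_⟩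
  · rw [iCocycles_cocyclesMap_apply, hz]
    rfl
  · exact (functor_map_π_apply (hf.repIso ε).hom i z).symm

lemma IsClassOf.smul {i : ℕ} {v : groupCohomology (gammaRep τ ε) i}
    {F : (Fin (i + 1) → GL (Fin n) ℚ) → V} (h : IsClassOf τ ε v F) (c : Fbar p) :
    IsClassOf τ ε (c • v) (fun x => c • F x) := by
  obtain ⟨z, hz, rfl⟩ := h
  refine ⟨c • z, fun g => ?_, map_smul _ _ _⟩
  rw [map_smul]
  exact congrArg (c • ·) (hz g)

lemma IsDetTwist.isHomogeneousCocycle (hf : IsDetTwist τ τ' s f) {i : ℕ}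
    {F : (Fin (i + 1) → GL (Fin n) ℚ) → V} (h : IsHomogeneousCocycle τ ε F) :
    IsHomogeneousCocycle τ' ε (fun x => f (F x)) := by
  refine ⟨fun γ x => ?_, fun x => ?_⟩
  · rw [hf.coeffRep_gammaIncl, ← h.1]
  · rw [← map_zero f, ← h.2 x, map_sum]
    exact Finset.sum_congr rfl fun j _ => (map_zsmul f _ _).symm

/-- All coset representatives `γ D` have the determinant of `D`, so the same scalar comes out of
every term of the sum. -/
lemma IsDetTwist.heckeCochain_apply (hf : IsDetTwist τ τ' s f) (D : heckeMonoid p n N) {i : ℕ}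
    (F : (Fin (i + 1) → GL (Fin n) ℚ) → V) (x : Fin (i + 1) → GL (Fin n) ℚ) :
    heckeCochain τ' ε D (fun x => f (F x)) x =
      detScalar s (redModP D) • f (heckeCochain τ ε D F x) := by
  -- An additive equivalence commutes with `finsum` unconditionally, so finiteness of the coset
  -- space need not be known.
  have h := f.toAddEquiv.map_finsum (fun c : Gamma0 n N ⧸ heckeStab D =>
    coeffRep τ ε (gammaIncl p c.out * D) (F fun j => (toGLQ (gammaIncl p c.out * D))⁻¹ * x j))
  rw [heckeCochain, heckeCochain]
  refine Eq.trans ?_ (congrArg (detScalar s (redModP D) • ·) h.symm)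
  rw [smul_finsum]
  refine finsum_congr fun c => ?_
  rw [hf.coeffRep_apply, map_mul redModP, detScalar_mul, detScalar_gammaIncl, one_mul]
  rfl

lemma IsDetTwist.isHeckeImage (hf : IsDetTwist τ τ' s f) {D : heckeMonoid p n N} {i : ℕ}
    {v w : groupCohomology (gammaRep τ ε) i} (h : IsHeckeImage τ ε D v w) :
    IsHeckeImage τ' ε D ((hf.cohomologyIso ε i).hom v)
      (detScalar s (redModP D) • (hf.cohomologyIso ε i).hom w) := by
  obtain ⟨F, hF, hv, hw⟩ := h
  refine ⟨fun x => f (F x), hf.isHomogeneousCocycle hF, hf.isClassOf hv, ?_⟩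
  have := (hf.isClassOf hw).smul (detScalar s (redModP D))
  convert this using 1
  ext x
  exact hf.heckeCochain_apply D F x

/-- The matrix of `T(ℓ,k)` has determinant `ℓ^k`, so its eigenvalue acquires the factor `ℓ^(sk)`.
This matches the characteristic polynomial of `ℓ^s ρ(Frob_ℓ)`, obtained from that of `ρ(Frob_ℓ)` by
`X ↦ ℓ^s X`. -/
lemma IsDetTwist.isAttached (hf : IsDetTwist τ τ' s f) {ρ : GQ →* GL (Fin n) (Fbar p)} {i : ℕ}
    {v : groupCohomology (gammaRep τ ε) i} (h : IsAttached τ ε ρ v) :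
    IsAttached τ' ε (twist ρ s) ((hf.cohomologyIso ε i).hom v) := by
  obtain ⟨hv, a, ha⟩ := h
  refine ⟨fun h0 => hv ?_, fun l k => ((l : Fbar p) ^ s) ^ k * a l k, fun l hl hlpN => ?_⟩
  · have h1 := (hf.cohomologyIso ε i).toLinearEquiv.map_eq_zero_iff (x := v)
    exact h1.1 h0
  obtain ⟨h1, h2, h3⟩ := ha l hl hlpN
  have hlp : l.Coprime p := (Nat.Prime.coprime_iff_not_dvd hl).2 fun h => hlpN (h.mul_right N)
  refine ⟨fun k hk => ?_, h2.twist hlp s, fun 𝔩 σ h𝔩 hσ => ?_⟩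
  · have := hf.isHeckeImage (h1 k hk)
    rw [map_smul, smul_smul, detScalar_redModP, det_heckeD hl hlpN hk] at this
    push_cast at this
    rwa [← zpow_natCast, zpow_comm, zpow_natCast] at this
  · rw [coe_twist, charpolyRev_smul, ← h3 𝔩 σ h𝔩 hσ, Units.val_zpow_eq_zpow_val,
      cyclo_of_isArithFrobAt hl hlp h𝔩 hσ, Polynomial.sum_comp]
    refine Finset.sum_congr rfl fun k _ => ?_
    rw [Polynomial.mul_comp, Polynomial.C_comp, Polynomial.X_pow_comp, mul_pow, ← Polynomial.C_pow]
    simp only [Polynomial.C_mul]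
    ring

end Hecke

/-! ## Unramifiedness of the extension generated by roots of unity of order `p` -/

section NumberFields

variable {K M : Type*} [Field K] [Field M] [NumberField K] [NumberField M] [Algebra K M]
  [IsGalois K M] {z : 𝓞 M} {m : ℕ}

/-- If `M = K(z)` with `z ^ m = 1`, then `m 𝓞_M ⊆ 𝓞_K[z]`. -/
lemma natCast_mul_eq_sum_of_pow_eq_one (hm : m ≠ 0) (hz : z ^ m = 1)
    (hgen : ∀ g : Gal(M/K), g (z : M) = z → g = 1) (x : 𝓞 M) :
    ∃ c : ℕ → 𝓞 K, (m : 𝓞 M) * x =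
      ∑ j ∈ Finset.range m, algebraMap (𝓞 K) (𝓞 M) (c j) * z ^ j := by
  have hm1 : m - 1 + 1 = m := Nat.sub_add_cancel (Nat.one_le_iff_ne_zero.2 hm)
  have hzM : (z : M) ^ m = 1 := by
    rw [← map_pow, hz, map_one]
  have hz0 : (z : M) ≠ 0 := fun h => by simp [h, hm] at hzM
  -- The coefficients are the traces of `x z^(-j)`; the inverse is written as `z^(m-1)` to remain
  -- among integers.
  have hex (j : ℕ) : ∃ c : 𝓞 K, algebraMap (𝓞 K) K c =
      Algebra.trace K M (algebraMap (𝓞 M) M (x * z ^ ((m - 1) * j))) :=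
    ⟨⟨_, Algebra.isIntegral_trace (NumberField.RingOfIntegers.isIntegral_coe _)⟩, rfl⟩
  choose c hc using hex
  refine ⟨c, NumberField.RingOfIntegers.coe_injective ?_⟩
  have hc' (j : ℕ) : algebraMap (𝓞 M) M (algebraMap (𝓞 K) (𝓞 M) (c j)) =
      ∑ g : Gal(M/K), g (x : M) * ((g (z : M))⁻¹) ^ j := by
    have h1 : algebraMap (𝓞 M) M (algebraMap (𝓞 K) (𝓞 M) (c j)) =
      algebraMap K M (algebraMap (𝓞 K) K (c j)) := rfl
    rw [h1, hc, trace_eq_sum_automorphisms]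
    refine Finset.sum_congr rfl fun g _ => ?_
    rw [map_mul, map_pow, map_mul, map_pow, pow_mul]
    congr 2
    rw [← map_inv₀, ← map_pow]
    congr 1
    exact eq_inv_of_mul_eq_one_left (by rw [← pow_succ, hm1, hzM])
  rw [map_mul, map_sum, map_natCast]
  simp only [map_mul, map_pow, hc', Finset.sum_mul]
  -- After the exchange of sums, the inner sum for `g` is geometric in the `m`-th root of unity
  -- `g(z)⁻¹ z`. It vanishes unless `g` fixes `z`, that is, unless `g = 1`, which contributes `m x`.
  rw [Finset.sum_comm, Finset.sum_eq_single 1]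
  · simp only [AlgEquiv.one_apply]
    have : ∀ j ∈ Finset.range m, (x : M) * ((z : M)⁻¹) ^ j * (z : M) ^ j = x := fun j _ => by
      rw [mul_assoc, ← mul_pow, inv_mul_cancel₀ hz0, one_pow, mul_one]
    rw [Finset.sum_congr rfl this]
    simp
  · intro g _ hg
    have hne : (g (z : M))⁻¹ * z ≠ 1 := fun h => hg <| hgen g <| by
      rwa [inv_mul_eq_one₀ ((map_ne_zero g).2 hz0)] at h
    have h2 := geom_sum_mul ((g (z : M))⁻¹ * z) m
    rw [mul_pow, inv_pow, ← map_pow, hzM, map_one, inv_one, mul_one, sub_self, mul_eq_zero,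
      sub_eq_zero] at h2
    simp only [mul_assoc, ← mul_pow, ← Finset.mul_sum]
    rw [h2.resolve_right hne, mul_zero]
  · simp

/-- A prime not dividing `m` is unramified in `K(z)`, if `z ^ m = 1`. -/
lemma mem_under_pow_of_pow_eq_one (hz : z ^ m = 1)
    (hgen : ∀ g : Gal(M/K), g (z : M) = z → g = 1) (Q : Ideal (𝓞 M)) [Q.IsPrime]
    (hm : (m : 𝓞 M) ∉ Q) (hQ : Q ≠ ⊥) {y : 𝓞 K} {i : ℕ}
    (hy : algebraMap (𝓞 K) (𝓞 M) y ∈ Q ^ i) : y ∈ (Q.under (𝓞 K)) ^ i := by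
  have hP : Q.under (𝓞 K) ≠ ⊥ := Ideal.IsIntegral.comap_ne_bot (R := 𝓞 K) hQ
  have hPne : NeZero (Q.under (𝓞 K)) := ⟨hP⟩
  -- An element of inertia fixes `z`, because `m`-th roots of unity stay distinct modulo `Q`; since
  -- `z` generates, inertia is trivial and the ramification index is one.
  have hcard : Nat.card (Q.inertia Gal(M/K)) = 1 := by
    rw [Nat.card_eq_one_iff_unique]
    refine ⟨⟨fun a b => ?_⟩, inferInstance⟩
    suffices ∀ g ∈ Q.inertia Gal(M/K), g = 1 from
      Subtype.ext ((this a a.2).trans (this b b.2).symm)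
    intro g hg
    refine hgen g ?_
    exact congrArg (algebraMap (𝓞 M) M) (smul_eq_self_of_pow_eq_one hz hm (hg z))
  have he : (Q.under (𝓞 K)).ramificationIdx' Q = 1 := by
    rw [Ideal.ramificationIdx'_eq_ramificationIdx _ _ hP,
      ← Ideal.ramificationIdxIn_eq_ramificationIdx (Q.under (𝓞 K)) Q Gal(M/K),
      ← Ideal.card_inertia_eq_ramificationIdxIn (G := Gal(M/K)) (Q.under (𝓞 K)) Q, hcard]
  -- With ramification index one the valuations at `Q` and below it agree on `𝓞 K`, and powers of
  -- the primes are read off from them.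
  let v : IsDedekindDomain.HeightOneSpectrum (𝓞 K) := ⟨Q.under (𝓞 K), inferInstance, hP⟩
  let w : IsDedekindDomain.HeightOneSpectrum (𝓞 M) := ⟨Q, inferInstance, hQ⟩
  have : w.asIdeal.LiesOver v.asIdeal := ⟨rfl⟩
  have hvw := IsDedekindDomain.HeightOneSpectrum.intValuation_liesOver v w y
  change v.intValuation y ^ ((Q.under (𝓞 K)).ramificationIdx' Q) = _ at hvw
  rw [he, pow_one] at hvw
  change y ∈ v.asIdeal ^ i
  rw [← v.intValuation_le_pow_iff_mem, hvw, w.intValuation_le_pow_iff_mem]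
  exact hy

end NumberFields

/-! ## Ramification groups -/

instance isAlgebraic_Qbar : Algebra.IsAlgebraic ℚ Qbar := AlgebraicClosure.isAlgebraic ℚ

instance isGalois_Qbar : IsGalois ℚ Qbar where
  to_normal :=
    have : IsAlgClosure ℚ Qbar := ⟨inferInstance, inferInstance⟩
    IsAlgClosure.normal ℚ Qbar

/-- The elements of `G_ℚ` that act trivially on `𝓞 K` modulo `(𝔮 ∩ 𝓞 K)^(i+1)`. -/
def ramSet (K : IntermediateField ℚ Qbar) (𝔮 : Ideal (𝓞 Qbar)) (i : ℕ) : Set GQ :=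
  {σ | ∀ x : 𝓞 K, ∃ y ∈ (𝔮.under (𝓞 K)) ^ (i + 1),
    σ • algebraMap (𝓞 K) (𝓞 Qbar) x - algebraMap (𝓞 K) (𝓞 Qbar) x = algebraMap (𝓞 K) (𝓞 Qbar) y}

lemma ramGroup_eq_ramSet (ρ : GQ →* GL (Fin n) (Fbar p)) (𝔮 : Ideal (𝓞 Qbar)) (i : ℕ) :
    ramGroup ρ 𝔮 i = ramSet (cutField ρ) 𝔮 i := rfl

lemma smul_algebraMap_of_mem_fixingSubgroup {K : IntermediateField ℚ Qbar} {h : GQ}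
    (hh : h ∈ K.fixingSubgroup) (x : 𝓞 K) :
    h • algebraMap (𝓞 K) (𝓞 Qbar) x = algebraMap (𝓞 K) (𝓞 Qbar) x :=
  NumberField.RingOfIntegers.ext (hh (x : K))

lemma mul_mem_ramSet {K : IntermediateField ℚ Qbar} {𝔮 : Ideal (𝓞 Qbar)} {i : ℕ} {σ h : GQ}
    (hσ : σ ∈ ramSet K 𝔮 i) (hh : h ∈ K.fixingSubgroup) : σ * h ∈ ramSet K 𝔮 i := by
  intro x
  rw [mul_smul, smul_algebraMap_of_mem_fixingSubgroup hh]
  exact hσ x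

lemma sub_mem_of_mem_ramSet {K : IntermediateField ℚ Qbar} {𝔮 : Ideal (𝓞 Qbar)} {i : ℕ} {σ : GQ}
    (hσ : σ ∈ ramSet K 𝔮 i) (x : 𝓞 K) :
    σ • algebraMap (𝓞 K) (𝓞 Qbar) x - algebraMap (𝓞 K) (𝓞 Qbar) x ∈ 𝔮 := by
  obtain ⟨y, hy, h⟩ := hσ x
  rw [h]
  exact Ideal.mem_comap.1 (Ideal.pow_le_self (Nat.succ_ne_zero i) hy)

/-- An algebraic integer that lies in `K` comes from `𝓞 K`. -/
lemma exists_algebraMap_eq {K : IntermediateField ℚ Qbar} {x : 𝓞 Qbar} (hx : (x : Qbar) ∈ K) :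
    ∃ y : 𝓞 K, algebraMap (𝓞 K) (𝓞 Qbar) y = x := by
  have hint : IsIntegral ℤ (⟨x, hx⟩ : K) := by
    rw [← isIntegral_algebraMap_iff (algebraMap K Qbar).injective]
    exact NumberField.RingOfIntegers.isIntegral_coe x
  exact ⟨⟨_, hint⟩, NumberField.RingOfIntegers.ext rfl⟩

lemma algebraMap_integers_injective (K : IntermediateField ℚ Qbar) :
    Function.Injective (algebraMap (𝓞 K) (𝓞 Qbar)) := fun _ _ h =>
  NumberField.RingOfIntegers.ext <| (algebraMap K Qbar).injective <|
    congrArg (algebraMap (𝓞 Qbar) Qbar) h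

/-- Inertia at `𝔮` surjects onto the inertia group of a subfield. -/
lemma exists_mul_mem_inert {K : IntermediateField ℚ Qbar} {𝔮 : Ideal (𝓞 Qbar)} [𝔮.IsPrime]
    {σ : GQ} (hσ : ∀ x : 𝓞 K,
      σ • algebraMap (𝓞 K) (𝓞 Qbar) x - algebraMap (𝓞 K) (𝓞 Qbar) x ∈ 𝔮) :
    ∃ h ∈ K.fixingSubgroup, σ * h ∈ inert 𝔮 := by
  have : CompactSpace K.fixingSubgroup :=
    isCompact_iff_compactSpace.1 (InfiniteGalois.fixingSubgroup_isClosed K).isCompact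
  have : SMulCommClass K.fixingSubgroup (𝓞 K) (𝓞 Qbar) := ⟨fun h a x => by
    rw [Algebra.smul_def, Algebra.smul_def, smul_mul']
    congr 1
    exact smul_algebraMap_of_mem_fixingSubgroup h.2 a⟩
  -- With the discrete topology on the integers the action is continuous, as needed for the
  -- profinite theorems on transitivity on primes and surjectivity onto residue automorphisms.
  let : TopologicalSpace (𝓞 Qbar) := ⊥
  have : DiscreteTopology (𝓞 Qbar) := ⟨rfl⟩
  have : ContinuousSMul K.fixingSubgroup (𝓞 Qbar) := by
    rw [continuousSMul_iff_stabilizer_isOpen]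
    intro x
    have h1 := (stabilizer_isOpen_of_isIntegral (K := ℚ) (x : Qbar)).preimage
      (continuous_subtype_val (p := (· ∈ K.fixingSubgroup)))
    convert h1 using 1
    ext h
    exact NumberField.RingOfIntegers.ext_iff
  have : Algebra.IsInvariant (𝓞 K) (𝓞 Qbar) K.fixingSubgroup := ⟨fun x hx => by
    refine exists_algebraMap_eq ?_
    rw [← InfiniteGalois.fixedField_fixingSubgroup K]
    exact fun h => congrArg (algebraMap (𝓞 Qbar) Qbar) (hx h)⟩
  -- As `σ` is trivial modulo `𝔮` on `𝓞 K`, the primes `𝔮` and `σ⁻¹ 𝔮` lie over the same prime of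
  -- `K`, so some `h` fixing `K` carries one to the other and `σ h` stabilizes `𝔮`.
  have hunder : 𝔮.under (𝓞 K) = (σ⁻¹ • 𝔮).under (𝓞 K) := by
    ext x
    rw [Ideal.mem_comap, Ideal.mem_comap, Ideal.mem_inv_pointwise_smul_iff]
    refine ⟨fun h => ?_, fun h => ?_⟩
    · simpa using add_mem (hσ x) h
    · simpa using sub_mem h (hσ x)
  obtain ⟨h, hh⟩ := Algebra.IsInvariant.exists_smul_of_under_eq_of_profinite (A := 𝓞 K)
    (G := K.fixingSubgroup) 𝔮 (σ⁻¹ • 𝔮) hunder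
  have hstab : (σ * h) • 𝔮 = 𝔮 := by
    have h1 : (h : GQ) • 𝔮 = σ⁻¹ • 𝔮 := hh.symm
    rw [mul_smul, h1, smul_inv_smul]
  -- The residue automorphism induced by `σ h` is linear over the residue ring of `K`, hence is
  -- induced by some `g` fixing `K`; then `σ h g⁻¹` lies in inertia.
  let E : (𝓞 Qbar ⧸ 𝔮) ≃+* (𝓞 Qbar ⧸ 𝔮) :=
    Ideal.quotientEquiv 𝔮 𝔮 (MulSemiringAction.toRingEquiv GQ (𝓞 Qbar) (σ * h)) hstab.symm
  let E' : (𝓞 Qbar ⧸ 𝔮) ≃ₐ[𝓞 K ⧸ 𝔮.under (𝓞 K)] (𝓞 Qbar ⧸ 𝔮) := AlgEquiv.ofRingEquiv (f := E) <| by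
    intro x
    obtain ⟨x, rfl⟩ := Ideal.Quotient.mk_surjective x
    change Ideal.Quotient.mk 𝔮 ((σ * h) • algebraMap (𝓞 K) (𝓞 Qbar) x) =
      Ideal.Quotient.mk 𝔮 (algebraMap (𝓞 K) (𝓞 Qbar) x)
    rw [Ideal.Quotient.eq, mul_smul, smul_algebraMap_of_mem_fixingSubgroup h.2]
    exact hσ x
  obtain ⟨g, hg⟩ := Ideal.Quotient.stabilizerHom_surjective_of_profinite
    (G := K.fixingSubgroup) (𝔮.under (𝓞 K)) 𝔮 E'
  refine ⟨(h * g.1⁻¹ : K.fixingSubgroup), (h * g.1⁻¹).2, fun x => ?_⟩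
  have h1 := DFunLike.congr_fun hg (Ideal.Quotient.mk 𝔮 ((g.1 : GQ)⁻¹ • x))
  have h2 : Ideal.Quotient.mk 𝔮 ((g.1 : GQ) • (g.1 : GQ)⁻¹ • x) =
    Ideal.Quotient.mk 𝔮 ((σ * h) • (g.1 : GQ)⁻¹ • x) := h1
  rw [smul_inv_smul, Ideal.Quotient.eq] at h2
  rw [← neg_mem_iff, neg_sub]
  change x - (σ * (h * (g.1 : GQ)⁻¹)) • x ∈ 𝔮
  rwa [← mul_assoc, mul_smul (σ * (h : GQ))]

/-- For elements of the inertia group, adjoining roots of unity of order prime to the residue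
characteristic does not change the ramification filtration. -/
lemma mem_ramSet_iff_of_le {q m : ℕ} (hqm : q.Coprime m) (hq : q ≠ 0)
    {K M : IntermediateField ℚ Qbar} [NumberField K] [NumberField M] [Normal ℚ K] [Normal ℚ M] (hKM : K ≤ M) {ζ : 𝓞 Qbar}
    (hζ : ζ ^ m = 1) (hζM : (ζ : Qbar) ∈ M)
    (hgen : ∀ σ ∈ K.fixingSubgroup, σ • ζ = ζ → σ ∈ M.fixingSubgroup)
    {𝔮 : Ideal (𝓞 Qbar)} (h𝔮 : IsPrimeAbove q 𝔮) {σ : GQ} (hσ : σ ∈ inert 𝔮) (i : ℕ) :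
    σ ∈ ramSet K 𝔮 i ↔ σ ∈ ramSet M 𝔮 i := by
  let : Algebra K M := (IntermediateField.inclusion hKM).toRingHom.toAlgebra
  have : IsScalarTower ℚ K M := IsScalarTower.of_algebraMap_eq fun _ => rfl
  have : IsGalois ℚ M := ⟨⟩
  have : IsGalois K M := IsGalois.tower_top_of_isGalois ℚ K M
  have htower (x : 𝓞 K) : algebraMap (𝓞 M) (𝓞 Qbar) (algebraMap (𝓞 K) (𝓞 M) x) =
    algebraMap (𝓞 K) (𝓞 Qbar) x := rfl
  have := h𝔮.1
  obtain ⟨z, hz⟩ := exists_algebraMap_eq hζM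
  have hzm : z ^ m = 1 := algebraMap_integers_injective M (by rw [map_pow, hz, hζ, map_one])
  -- The generation hypothesis concerns `G_ℚ`, so `g` is first lifted to an automorphism of `Qbar`.
  have hgen' (g : Gal(M/K)) (hg : g (z : M) = z) : g = 1 := by
    let τ : GQ := (g.restrictScalars ℚ).liftNormal Qbar
    have hτ (x : M) : τ (x : Qbar) = (g x : M) := (g.restrictScalars ℚ).liftNormal_commutes Qbar x
    have h1 : τ ∈ M.fixingSubgroup := by
      refine hgen τ (fun x => ?_) (NumberField.RingOfIntegers.ext ?_)
      · have h2 := hτ (algebraMap K M x)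
        rw [g.commutes] at h2
        exact h2
      · rw [← hz]
        exact (hτ (z : M)).trans (congrArg (algebraMap M Qbar) hg)
    ext x
    exact (hτ x).symm.trans (h1 x)
  have hm𝔮 := h𝔮.natCast_notMem hqm
  have hm0 : m ≠ 0 := fun h => hm𝔮 (by simp [h])
  have hunder : (𝔮.under (𝓞 M)).under (𝓞 K) = 𝔮.under (𝓞 K) := rfl
  constructor
  · intro hσK x
    -- Expand `m x` in powers of `z`. Inertia fixes `ζ`, so `σ` moves only the coefficients, where
    -- the congruence over `K` applies.
    obtain ⟨c, hc⟩ := natCast_mul_eq_sum_of_pow_eq_one hm0 hzm hgen' x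
    choose y hy hσy using fun j => hσK (c j)
    have hζσ : σ • ζ = ζ := smul_eq_self_of_pow_eq_one hζ hm𝔮 (hσ ζ)
    set Y : 𝓞 M := ∑ j ∈ Finset.range m, algebraMap (𝓞 K) (𝓞 M) (y j) * z ^ j with hY
    have hYmem : Y ∈ (𝔮.under (𝓞 M)) ^ (i + 1) := by
      refine sum_mem fun j _ => Ideal.mul_mem_right _ _ ?_
      have h1 := Ideal.mem_map_of_mem (algebraMap (𝓞 K) (𝓞 M)) (hy j)
      rw [Ideal.map_pow, ← hunder] at h1
      exact Ideal.pow_right_mono Ideal.map_comap_le _ h1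
    have hmul : (m : 𝓞 Qbar) * (σ • algebraMap (𝓞 M) (𝓞 Qbar) x - algebraMap (𝓞 M) (𝓞 Qbar) x) =
        algebraMap (𝓞 M) (𝓞 Qbar) Y := by
      have h1 : σ • ((m : 𝓞 Qbar) * algebraMap (𝓞 M) (𝓞 Qbar) x) =
          (m : 𝓞 Qbar) * σ • algebraMap (𝓞 M) (𝓞 Qbar) x := by
        rw [smul_mul']
        congr 1
        exact map_natCast (MulSemiringAction.toRingHom GQ (𝓞 Qbar) σ) m
      have h2 : (m : 𝓞 Qbar) * algebraMap (𝓞 M) (𝓞 Qbar) x =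
          ∑ j ∈ Finset.range m, algebraMap (𝓞 K) (𝓞 Qbar) (c j) * ζ ^ j := by
        rw [← map_natCast (algebraMap (𝓞 M) (𝓞 Qbar)), ← map_mul, hc, map_sum]
        simp only [map_mul, map_pow, htower, hz]
      rw [mul_sub, ← h1, h2, Finset.smul_sum, ← Finset.sum_sub_distrib, hY, map_sum]
      refine Finset.sum_congr rfl fun j _ => ?_
      rw [smul_mul', smul_pow', hζσ, ← sub_mul, hσy, map_mul, map_pow, htower, hz]
    -- The difference must be an integer of `M` itself; normality of `M` guarantees this.
    have hM : ((σ • algebraMap (𝓞 M) (𝓞 Qbar) x - algebraMap (𝓞 M) (𝓞 Qbar) x : 𝓞 Qbar) : Qbar) ∈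
        M := by
      refine sub_mem ?_ (x : M).2
      exact (IntermediateField.normal_iff_forall_map_le.1 ‹Normal ℚ M› σ) ⟨_, (x : M).2, rfl⟩
    obtain ⟨y', hy'⟩ := exists_algebraMap_eq hM
    refine ⟨y', ?_, hy'.symm⟩
    have hmy : (m : 𝓞 M) * y' = Y := algebraMap_integers_injective M (by
      rw [map_mul, map_natCast, hy', hmul])
    -- The factor `m` is removed by a Bézout relation with `q^(i+1)`, which already lies in the
    -- required power of the prime.
    obtain ⟨a, b, hab⟩ := Nat.isCoprime_iff_coprime.2 (hqm.pow_left (i + 1))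
    have hq' : (q : 𝓞 M) ^ (i + 1) ∈ (𝔮.under (𝓞 M)) ^ (i + 1) := by
      refine Ideal.pow_mem_pow ?_ _
      rw [Ideal.mem_comap, map_natCast]
      exact h𝔮.2
    have h1 : ((a * ((q ^ (i + 1) : ℕ) : ℤ) + b * m : ℤ) : 𝓞 M) = 1 := by rw [hab]; simp
    have h2 : y' = (a * y') * q ^ (i + 1) + b * Y := by
      rw [← hmy]
      calc y' = ((a * ((q ^ (i + 1) : ℕ) : ℤ) + b * m : ℤ) : 𝓞 M) * y' := by rw [h1, one_mul]
        _ = _ := by push_cast; ring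
    rw [h2]
    exact add_mem (Ideal.mul_mem_left _ _ hq') (Ideal.mul_mem_left _ _ hYmem)
  · intro hσM x
    obtain ⟨y, hy, hσy⟩ := hσM (algebraMap (𝓞 K) (𝓞 M) x)
    rw [htower] at hσy
    have hK : ((σ • algebraMap (𝓞 K) (𝓞 Qbar) x - algebraMap (𝓞 K) (𝓞 Qbar) x : 𝓞 Qbar) : Qbar) ∈
        K := by
      refine sub_mem ?_ (x : K).2
      exact (IntermediateField.normal_iff_forall_map_le.1 ‹Normal ℚ K› σ) ⟨_, (x : K).2, rfl⟩
    obtain ⟨y', hy'⟩ := exists_algebraMap_eq hK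
    refine ⟨y', ?_, hy'.symm⟩
    have hyy : algebraMap (𝓞 K) (𝓞 M) y' = y := algebraMap_integers_injective M (by
      rw [htower, hy', hσy])
    rw [← hunder]
    -- The congruence over `M` descends to `K` with the same exponent because `M / K` is unramified
    -- at this prime.
    refine mem_under_pow_of_pow_eq_one hzm hgen' (𝔮.under (𝓞 M)) ?_ ?_ (hyy ▸ hy)
    · rwa [Ideal.mem_comap, map_natCast]
    · intro hbot
      have h1 : (q : 𝓞 M) ∈ 𝔮.under (𝓞 M) := by
        rw [Ideal.mem_comap, map_natCast]
        exact h𝔮.2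
      rw [hbot, Ideal.mem_bot, Nat.cast_eq_zero] at h1
      exact hq h1

/-! ## Invariance of the level -/

section OpenSubgroups

variable {H : Subgroup GQ}

/-- Open subgroups are closed, so the infinite Galois correspondence applies; continuity of `ρ`
enters the computation of the level through this openness. -/
lemma fixingSubgroup_fixedField_of_isOpen (hH : IsOpen (H : Set GQ)) :
    (IntermediateField.fixedField H).fixingSubgroup = H :=
  InfiniteGalois.fixingSubgroup_fixedField ⟨H, H.isClosed_of_isOpen hH⟩

lemma numberField_fixedField_of_isOpen (hH : IsOpen (H : Set GQ)) :
    NumberField (IntermediateField.fixedField H) where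
  to_finiteDimensional := by
    rw [← InfiniteGalois.isOpen_iff_finite]
    change IsOpen ((IntermediateField.fixedField H).fixingSubgroup : Set GQ)
    rwa [fixingSubgroup_fixedField_of_isOpen hH]

lemma normal_fixedField (H : Subgroup GQ) [H.Normal] :
    Normal ℚ (IntermediateField.fixedField H) := by
  refine IntermediateField.normal_iff_forall_map_le'.2 ?_
  rintro σ _ ⟨x, hx, rfl⟩ h
  have h1 := hx ⟨σ⁻¹ * h * σ, by simpa using (inferInstance : H.Normal).conj_mem h h.2 σ⁻¹⟩
  have h2 : σ⁻¹ ((h : GQ) (σ x)) = x := h1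
  have h3 := congrArg σ h2
  have h4 : σ (σ⁻¹ ((h : GQ) (σ x))) = (h : GQ) (σ x) := AlgEquiv.apply_symm_apply σ _
  exact h4.symm.trans h3

end OpenSubgroups

lemma isOpen_ker_cyclo (p : ℕ) [Fact p.Prime] : IsOpen ((cyclo p).ker : Set GQ) := by
  obtain ⟨ζ, hζ⟩ := exists_primitiveRoot p
  refine Subgroup.isOpen_mono (H₁ := MulAction.stabilizer GQ (ζ : Qbar)) (fun σ hσ => ?_)
    (stabilizer_isOpen_of_isIntegral (K := ℚ) (ζ : Qbar))
  exact (cyclo_eq_one_iff hζ).2 (NumberField.RingOfIntegers.ext hσ)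

lemma IsContinuousRep.isOpen_ker {ρ : GQ →* GL (Fin n) (Fbar p)} (h : IsContinuousRep ρ) :
    IsOpen (ρ.ker : Set GQ) :=
  let _ : TopologicalSpace (GL (Fin n) (Fbar p)) := ⊥
  have : DiscreteTopology (GL (Fin n) (Fbar p)) := ⟨rfl⟩
  (isOpen_discrete {1}).preimage h

/-- Supplies the common field: adjoining a `p`-th root of unity to the field cut out by `ρ` or by
its twist gives the same extension. -/
lemma ker_twist_inf_ker_cyclo (ρ : GQ →* GL (Fin n) (Fbar p)) (s : ℤ) :
    (twist ρ s).ker ⊓ (cyclo p).ker = ρ.ker ⊓ (cyclo p).ker := by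
  ext σ
  simp only [Subgroup.mem_inf, MonoidHom.mem_ker]
  refine and_congr_left fun h => ?_
  rw [twist_eq_of_cyclo_eq_one ρ s h]

/-- The image of a ramification group can be computed in the extension by the roots of unity of
order `p`. -/
lemma image_ramGroup {ρ : GQ →* GL (Fin n) (Fbar p)} (hρ : IsOpen (ρ.ker : Set GQ)) {q : ℕ}
    (hqp : q.Coprime p) (hq : q ≠ 0) {𝔮 : Ideal (𝓞 Qbar)} (h𝔮 : IsPrimeAbove q 𝔮) (i : ℕ) :
    ρ '' ramGroup ρ 𝔮 i = ρ '' (inert 𝔮 ∩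
      ramSet (IntermediateField.fixedField (ρ.ker ⊓ (cyclo p).ker)) 𝔮 i) := by
  have hopen : IsOpen ((ρ.ker ⊓ (cyclo p).ker : Subgroup GQ) : Set GQ) :=
    hρ.inter (isOpen_ker_cyclo p)
  obtain ⟨ζ, hζ⟩ := exists_primitiveRoot p
  have := numberField_fixedField_of_isOpen hρ
  have := numberField_fixedField_of_isOpen hopen
  have := normal_fixedField ρ.ker
  have := normal_fixedField (ρ.ker ⊓ (cyclo p).ker)
  have := h𝔮.1
  have hiff {σ : GQ} (hσ : σ ∈ inert 𝔮) : σ ∈ ramGroup ρ 𝔮 i ↔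
      σ ∈ ramSet (IntermediateField.fixedField (ρ.ker ⊓ (cyclo p).ker)) 𝔮 i := by
    rw [ramGroup_eq_ramSet]
    refine mem_ramSet_iff_of_le hqp hq (IntermediateField.fixedField_le inf_le_left)
      hζ.pow_eq_one ?_ ?_ h𝔮 hσ i
    · intro h
      exact congrArg (algebraMap (𝓞 Qbar) Qbar) ((cyclo_eq_one_iff hζ).1 h.2.2)
    · intro σ hσ hσζ
      rw [fixingSubgroup_fixedField_of_isOpen hρ] at hσ
      rw [fixingSubgroup_fixedField_of_isOpen hopen]
      exact ⟨hσ, (cyclo_eq_one_iff hζ).2 hσζ⟩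
  ext A
  constructor
  · rintro ⟨σ, hσ, rfl⟩
    -- `ramGroup` is a full preimage and need not lie in `inert 𝔮`; correcting `σ` by an element of
    -- `ρ.ker` brings it there without changing its image.
    obtain ⟨h, hh, hmem⟩ := exists_mul_mem_inert (sub_mem_of_mem_ramSet (K := cutField ρ) hσ)
    refine ⟨σ * h, ⟨hmem, (hiff hmem).1 (mul_mem_ramSet (K := cutField ρ) hσ hh)⟩, ?_⟩
    rw [fixingSubgroup_fixedField_of_isOpen hρ] at hh
    rw [map_mul, hh, mul_one]
  · rintro ⟨σ, ⟨hσ, hσ'⟩, rfl⟩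
    exact ⟨σ, (hiff hσ).2 hσ', rfl⟩

lemma fixedVectors_eq_of_image_eq {ρ ρ' : GQ →* GL (Fin n) (Fbar p)} {T T' : Set GQ}
    (h : ρ '' T = ρ' '' T') : fixedVectors ρ T = fixedVectors ρ' T' := by
  have hmem (ρ : GQ →* GL (Fin n) (Fbar p)) (T : Set GQ) (v : Fin n → Fbar p) :
      v ∈ fixedVectors ρ T ↔
        ∀ A ∈ ρ '' T, (A : Matrix (Fin n) (Fin n) (Fbar p)).mulVec v = v := by
    simp only [fixedVectors, Submodule.mem_iInf, LinearMap.mem_ker, LinearMap.sub_apply,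
      LinearMap.id_apply, sub_eq_zero, Set.forall_mem_image]
    rfl
  ext v
  rw [hmem, hmem, h]

/-- Both images are computed inside inertia over the common field of `ker_twist_inf_ker_cyclo`, and
there `ω` is trivial, so `ρ` and its twist agree elementwise. -/
lemma image_ramGroup_twist {ρ : GQ →* GL (Fin n) (Fbar p)} (hρ : IsContinuousRep ρ) (s : ℤ) {q : ℕ}
    (hqp : q.Coprime p) (hq : q ≠ 0) {𝔮 : Ideal (𝓞 Qbar)} (h𝔮 : IsPrimeAbove q 𝔮) (i : ℕ) :
    twist ρ s '' ramGroup (twist ρ s) 𝔮 i = ρ '' ramGroup ρ 𝔮 i := by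
  have hopen : IsOpen ((twist ρ s).ker : Set GQ) := by
    refine Subgroup.isOpen_mono (H₁ := ρ.ker ⊓ (cyclo p).ker) ?_
      (hρ.isOpen_ker.inter (isOpen_ker_cyclo p))
    rw [← ker_twist_inf_ker_cyclo ρ s]
    exact inf_le_left
  rw [image_ramGroup hopen hqp hq h𝔮, image_ramGroup hρ.isOpen_ker hqp hq h𝔮,
    ker_twist_inf_ker_cyclo]
  exact Set.image_congr fun σ hσ =>
    twist_eq_of_cyclo_eq_one ρ s (cyclo_eq_one_of_mem_inert hqp h𝔮 hσ.1)

lemma conductorExponent_twist {ρ : GQ →* GL (Fin n) (Fbar p)} (hρ : IsContinuousRep ρ) (s : ℤ)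
    {q : ℕ} (hqp : q.Coprime p) (hq : q ≠ 0) {𝔮 : Ideal (𝓞 Qbar)} (h𝔮 : IsPrimeAbove q 𝔮) :
    conductorExponent (twist ρ s) 𝔮 = conductorExponent ρ 𝔮 := by
  have h := image_ramGroup_twist hρ s hqp hq h𝔮
  refine finsum_congr fun i => ?_
  rw [h, h, fixedVectors_eq_of_image_eq (h i)]

lemma level_twist {𝔔 : ℕ → Ideal (𝓞 Qbar)} (h𝔔 : ∀ q : ℕ, q.Prime → IsPrimeAbove q (𝔔 q))
    {ρ : GQ →* GL (Fin n) (Fbar p)} (hρ : IsContinuousRep ρ) (s : ℤ) :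
    level 𝔔 (twist ρ s) = level 𝔔 ρ := by
  refine finprod_congr fun q => finprod_congr fun hq => ?_
  rw [conductorExponent_twist hρ s ((Nat.coprime_primes hq.1 Fact.out).2 hq.2) hq.1.ne_zero
    (h𝔔 q hq.1)]

/-! ## The conjecture for twists -/

section Conjecture

variable [NeZero n] {𝔔 : ℕ → Ideal (𝓞 Qbar)} {ρ : GQ →* GL (Fin n) (Fbar p)}

lemma exists_mem_predictedWeights_twist (h𝔓 : IsPrimeAbove p (𝔔 p)) (s : ℤ) {b : Fin n → ℤ}
    (hb : b ∈ predictedWeights 𝔔 ρ) :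
    ∃ t : ℤ, s ≡ t [ZMOD (p : ℤ) - 1] ∧
      (fun i => b i + t) ∈ predictedWeights 𝔔 (twist ρ s) := by
  obtain ⟨S, a, hS, ha, hab⟩ := hb
  obtain ⟨t, hst, ht⟩ := hab.add_const s
  exact ⟨t, hst, S, _, hS.twist s, ha.twist h𝔓 s, ht⟩

lemma ConjectureFor.twist (h : ConjectureFor 𝔔 ρ)
    (h𝔔 : ∀ q : ℕ, q.Prime → IsPrimeAbove q (𝔔 q)) (hρ : IsContinuousRep ρ) (s : ℤ) :
    ConjectureFor 𝔔 (twist ρ s) := by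
  intro S a hS ha
  have hS' : StrictParity ρ S := by simpa only [twist_twist_neg] using hS.twist (-s)
  have ha' : IsDerivedTuple ρ (𝔔 p) S (fun i => a i + -s) := by
    simpa only [twist_twist_neg] using ha.twist (h𝔔 p Fact.out) (-s)
  obtain ⟨ε, b, i, v, hε, hab, hv⟩ := h S _ hS' ha'
  obtain ⟨t, hst, ht⟩ := hab.add_const s
  simp only [neg_add_cancel_right] at ht
  -- The level occurs in the type of `ε`; rewriting it before any witness is given lets the
  -- character found for `ρ` be reused unchanged.
  rw [level_twist h𝔔 hρ s]
  have hf : IsDetTwist (weightRep p b) (weightRep p fun i => b i + t) s (weightTwist p b t) :=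
    weightRep_weightTwist b hst
  exact ⟨ε, _, i, _, hε.twist s, ht, hf.isAttached hv⟩

end Conjecture

end ADP

end

theorem theorem3p6 (p : ℕ) [Fact p.Prime] (n : ℕ) [NeZero n]
    (𝔔 : ℕ → Ideal (NumberField.RingOfIntegers ADP.Qbar))
    (h𝔔 : ∀ q : ℕ, q.Prime → ADP.IsPrimeAbove q (𝔔 q))
    (ρ : ADP.GQ →* GL (Fin n) (ADP.Fbar p))
    (hcont : ADP.IsContinuousRep ρ) (hss : ADP.IsSemisimpleRep ρ) (s : ℤ) :
    (ADP.ConjectureFor 𝔔 ρ → ADP.ConjectureFor 𝔔 (ADP.twist ρ s)) ∧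
    ADP.level 𝔔 (ADP.twist ρ s) = ADP.level 𝔔 ρ ∧
    (∀ (N : ℕ) (ε : DirichletCharacter (ADP.Fbar p) N),
      ADP.IsNebentype (ADP.twist ρ s) ε ↔ ADP.IsNebentype ρ ε) ∧
    (∀ (S : Setoid (Fin n)) (a : Fin n → ℤ),
      ADP.IsDerivedTuple (ADP.twist ρ s) (𝔔 p) S (fun i => a i + s) ↔
        ADP.IsDerivedTuple ρ (𝔔 p) S a) ∧
    (∀ b ∈ ADP.predictedWeights 𝔔 ρ, ∃ b' ∈ ADP.predictedWeights 𝔔 (ADP.twist ρ s),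
      Nonempty ((ADP.weightRep p b').Equiv
        ((ADP.weightRep p b).tprod (ADP.detRep p n s)))) ∧
    (∀ b' ∈ ADP.predictedWeights 𝔔 (ADP.twist ρ s), ∃ b ∈ ADP.predictedWeights 𝔔 ρ,
      Nonempty ((ADP.weightRep p b').Equiv
        ((ADP.weightRep p b).tprod (ADP.detRep p n s)))) := by
  refine ⟨fun h => h.twist h𝔔 hcont s, ADP.level_twist h𝔔 hcont s,
    fun N ε => ADP.isNebentype_twist_iff s,
    fun S a => ADP.isDerivedTuple_twist_iff (h𝔔 p Fact.out) s, fun b hb => ?_, fun b' hb' => ?_⟩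
  · obtain ⟨t, hst, ht⟩ := ADP.exists_mem_predictedWeights_twist (h𝔔 p Fact.out) s hb
    exact ⟨_, ht, ADP.nonempty_weightRep_equiv b hst⟩
  · obtain ⟨t, hst, ht⟩ := ADP.exists_mem_predictedWeights_twist (h𝔔 p Fact.out) (-s) hb'
    rw [ADP.twist_twist_neg] at ht
    refine ⟨_, ht, ?_⟩
    have h := ADP.nonempty_weightRep_equiv (p := p) (fun i => b' i + t)
      (s := s) (t := -t) (by simpa using hst.neg)
    have he : (fun i => b' i + t + -t) = b' := funext fun i => add_neg_cancel_right _ _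
    rwa [he] at h
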